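/- **Setting.** Let $\mathcal I=\{1,\dots,N\}$ be the agents of an undirected network, and let $\mathcal N_i$ denote the set of neighbors of agent $i$, with the convention $i\in\mathcal N_i$. Consider $$\min_{x_i\in\mathbb R^{n_i},\,i\in\mathcal I}\ \sum_{i\in\mathcal I} f_i(x_i)\quad\text{s.t.}\quad \sum_{j\in\mathcal N_i}c_{i,j}(x_j)\le \mathbf 0_{p_i},\qquad \sum_{j\in\mathcal N_i}a_{i,j}(x_j)=\mathbf 0_{r_i}\qquad(\forall i\in\mathcal I),\tag{P}$$ where $f_i:\mathbb R^{n_i}\to\mathbb R\cup\{\infty\}$, $c_{i,j}:\mathbb R^{n_j}\to\mathbb R^{p_i}$ and $a_{i,j}(x_j)=A_{i,j}x_j-b_{i,j}\in\mathbb R^{r_i}$ is affine. Write $f(x)=\sum_i f_i(x_i)$, $g_{i,j}=\mathrm{col}(c_{i,j},a_{i,j})$ and $\Omega_i=\mathbb R_{\ge 0}^{p_i}\times\mathbb R^{r_i}$; all norms are Euclidean. Assume: * each $f_i$ is proper, closed and $\rho_i$-strongly convex, $\rho_i>0$; * for all $i\in\mathcal I$ and $j\in\mathcal N_i$, $g_{i,j}$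 is componentwise convex and $\theta_{i,j}$-Lipschitz on $\operatorname{dom}(f_j)$, $\theta_{i,j}>0$; * there is $\bar x\in\operatorname{int}(\operatorname{dom}(f))$ with $\sum_{j\in\mathcal N_i}c_{i,j}(\bar x_j)<\mathbf 0$ and $\sum_{j\in\mathcal N_i}a_{i,j}(\bar x_j)=\mathbf 0$ for all $i$; * the block matrix $A=[A_{i,j}]_{i,j\in\mathcal I}$, with $A_{i,j}=0$ for $j\notin\mathcal N_i$, has full row rank. **Algorithm.** Let $\gamma_i>0$, $T_i\subseteq\mathbb N$, and let $\tau_{i,j}^k\in\{0,\dots,k\}$ for $j\in\mathcal N_i$, $k\in\mathbb N$. Set $y_i(0)=\mathbf 0$ and $x_i(0)=\operatorname{argmin}f_i$. For every $k\in\mathbb N$ and $i\in\mathcal I$: if $k\in T_i$, $$x_i(k+1)=\operatorname*{argmin}_{x_i\in\mathbb R^{n_i}}\Big(f_i(x_i)+\sum_{j\in\mathcal N_i}\langle g_{j,i}(x_i),y_j(\tau_{i,j}^k)\rangle\Big),\qquad y_i(k+1)=\mathrm{proj}_{\Omega_i}\Big(y_i(k)+\gamma_i\sum_{j\in\mathcal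 N_i}g_{i,j}(x_j(\tau_{i,j}^k))\Big),$$ and otherwise $x_i(k+1)=x_i(k)$, $y_i(k+1)=y_i(k)$. Assume partial asynchronism with a positive integer $Q$: for all $k\in\mathbb N$ and $i\in\mathcal I$, $\{k,\dots,k+Q-1\}\cap T_i\neq\varnothing$, and $k-Q\le\tau_{i,j}^k\le k$ for all $j\in\mathcal N_i$. **Theorem.** For all $i\in\mathcal I$ let $$\theta_i=\sqrt{\sum_{j\in\mathcal N_i}\theta_{j,i}^2},\qquad \phi_i=\sum_{j\in\mathcal N_i}\frac{\theta_j^2}{\rho_j},\qquad \ell_i=\sum_{j\in\mathcal N_i}\theta_{i,j}\frac{\theta_j}{\rho_j},\qquad \xi_i=\sum_{j\in\mathcal N_i}\sum_{l\in\mathcal N_j}\theta_{l,j}\frac{\theta_j}{\rho_j},$$ and assume that $$\gamma_i^{-1}>\tfrac12\phi_i+\tfrac32Q(\ell_i+\xi_i)\qquad\text{for all } i\in\mathcal I.$$ Then (P) has a unique solution $x^\star$, the algorithm is well defined, and the sequence $(x(k))_{k\in\mathbb N}$ that it generates converges to $x^\star$. -/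

import Mathlib

open scoped BigOperators Topology

noncomputable section

/-- The effective domain of an extended-valued function. -/
def effDom {E : Type*} (f : E → EReal) : Set E := {x | f x < ⊤}

/-- Proper: never `-∞`, and finite somewhere. -/
def ProperFun {E : Type*} (f : E → EReal) : Prop :=
  (∀ x, f x ≠ ⊥) ∧ (effDom f).Nonempty

/-- `ρ`-strong convexity of an extended-valued function: `f - (ρ/2)‖·‖²` is convex, that is, its
effective domain is convex and it satisfies the convexity inequality there. -/
def StronglyConvexFun {E : Type*} [NormedAddCommGroup E] [NormedSpace ℝ E]
    (ρ : ℝ) (f : E → EReal) : Prop :=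
  ConvexOn ℝ (effDom f) (fun x => (f x).toReal - ρ / 2 * ‖x‖ ^ 2)

/-- `z` is a global minimizer of `F`. -/
def IsArgmin {E : Type*} (F : E → EReal) (z : E) : Prop := ∀ w, F z ≤ F w

/-- `v` is a Euclidean projection of `u` onto `S`. -/
def IsProj {E : Type*} [NormedAddCommGroup E] (S : Set E) (u v : E) : Prop :=
  v ∈ S ∧ ∀ w ∈ S, ‖u - v‖ ≤ ‖u - w‖

/-- The data of a separable problem over an undirected network with agents `ι`: decision dimensions
`n i`, local costs `f i`, and, for agent `i`, `p i` inequality and `r i` equality constraints to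
which agent `j` contributes `c i j` and `x ↦ A i j x - b i j` respectively. Only the data with
`j` in the closed neighborhood of `i` are ever used. -/
structure CoupledProblem (ι : Type*) where
  /-- the communication network -/
  G : SimpleGraph ι
  /-- dimensions of the decision variables -/
  n : ι → ℕ
  /-- numbers of inequality constraints -/
  p : ι → ℕ
  /-- numbers of equality constraints -/
  r : ι → ℕ
  /-- local costs -/
  f : ∀ i, EuclideanSpace ℝ (Fin (n i)) → EReal
  /-- inequality constraint functions -/
  c : ∀ i j, EuclideanSpace ℝ (Fin (n j)) → EuclideanSpace ℝ (Fin (p i))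
  /-- matrices of the affine equality constraints -/
  A : ∀ i j, Matrix (Fin (r i)) (Fin (n j)) ℝ
  /-- offsets of the affine equality constraints -/
  b : ∀ i, ι → EuclideanSpace ℝ (Fin (r i))

namespace CoupledProblem

variable {ι : Type*} (P : CoupledProblem ι)

/-- Collections of decision variables, one for each agent. -/
abbrev Primal : Type _ := ∀ i, EuclideanSpace ℝ (Fin (P.n i))

/-- The space of the multipliers of agent `i` (inequality part, then equality part). -/
abbrev DualBlock (i : ι) : Type := EuclideanSpace ℝ (Fin (P.p i) ⊕ Fin (P.r i))

/-- Collections of dual variables, one for each agent. -/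
abbrev Dual : Type _ := ∀ i, P.DualBlock i

/-- The affine map `x ↦ A i j x - b i j`. -/
def a (i j : ι) (x : EuclideanSpace ℝ (Fin (P.n j))) : EuclideanSpace ℝ (Fin (P.r i)) :=
  WithLp.toLp 2 ((P.A i j).mulVec (WithLp.ofLp x)) - P.b i j

/-- The stacked constraint map `col (c i j, a i j)`. -/
def g (i j : ι) (x : EuclideanSpace ℝ (Fin (P.n j))) : P.DualBlock i :=
  WithLp.toLp 2 (Sum.elim (fun s => P.c i j x s) (fun t => P.a i j x t))

/-- The multiplier set of agent `i`: nonnegative inequality part, free equality part. -/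
def Ω (i : ι) : Set (P.DualBlock i) := {y | ∀ s : Fin (P.p i), 0 ≤ y (Sum.inl s)}

variable [Fintype ι]

open Classical in
/-- The neighbors of agent `i`, which include `i` itself. -/
def nbrs (i : ι) : Finset ι := Finset.univ.filter (fun j => j = i ∨ P.G.Adj i j)

/-- The total cost. -/
def cost (x : P.Primal) : EReal := ∑ i, P.f i (x i)

/-- The feasible set of the coupling constraints. -/
def feasible : Set P.Primal :=
  {x | ∀ i, (∀ s : Fin (P.p i), ∑ j ∈ P.nbrs i, P.c i j (x j) s ≤ 0) ∧
    ∑ j ∈ P.nbrs i, P.a i j (x j) = 0}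

/-- `x` solves the constrained minimization problem. -/
def IsSolution (x : P.Primal) : Prop :=
  x ∈ P.feasible ∧ ∀ z ∈ P.feasible, P.cost x ≤ P.cost z

open Classical in
/-- The matrix of all the equality constraints, with zero blocks for pairs of non-neighbors. -/
def bigA : Matrix (Σ i, Fin (P.r i)) (Σ j, Fin (P.n j)) ℝ :=
  fun s t => if t.1 ∈ P.nbrs s.1 then P.A s.1 t.1 s.2 t.2 else 0

/-- The standing assumptions, with strong convexity constants `ρ i` of `f i` and Lipschitz
constants `θ i j` of `g i j`. -/
structure Regular (ρ : ι → ℝ) (θ : ι → ι → ℝ) : Prop where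
  rho_pos : ∀ i, 0 < ρ i
  proper : ∀ i, ProperFun (P.f i)
  closed : ∀ i, LowerSemicontinuous (P.f i)
  strongly_convex : ∀ i, StronglyConvexFun (ρ i) (P.f i)
  theta_pos : ∀ i, ∀ j ∈ P.nbrs i, 0 < θ i j
  convex : ∀ i, ∀ j ∈ P.nbrs i, ∀ s, ConvexOn ℝ (effDom (P.f j)) (fun x => P.g i j x s)
  lipschitz : ∀ i, ∀ j ∈ P.nbrs i, ∀ x ∈ effDom (P.f j), ∀ z ∈ effDom (P.f j),
    ‖P.g i j x - P.g i j z‖ ≤ θ i j * ‖x - z‖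
  slater : ∃ x ∈ interior (effDom P.cost), ∀ i,
    (∀ s : Fin (P.p i), ∑ j ∈ P.nbrs i, P.c i j (x j) s < 0) ∧
    ∑ j ∈ P.nbrs i, P.a i j (x j) = 0
  full_row_rank : LinearIndependent ℝ P.bigA.row

/-- Partial asynchronism with bound `Q`: agent `i` updates at the times in `T i`, and at time `k`
uses the information of agent `j` from time `τ i j k`. -/
structure PartiallyAsync (Q : ℕ) (T : ι → Set ℕ) (τ : ι → ι → ℕ → ℕ) : Prop where
  Q_pos : 0 < Q
  update : ∀ k i, ∃ t ∈ T i, k ≤ t ∧ t ≤ k + Q - 1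
  not_future : ∀ k i, ∀ j ∈ P.nbrs i, τ i j k ≤ k
  delay : ∀ k i, ∀ j ∈ P.nbrs i, k ≤ τ i j k + Q

/-- `(x, y)` is generated by the asynchronous distributed dual ascent. -/
structure IsRun (γ : ι → ℝ) (T : ι → Set ℕ) (τ : ι → ι → ℕ → ℕ)
    (x : ℕ → P.Primal) (y : ℕ → P.Dual) : Prop where
  y_init : ∀ i, y 0 i = 0
  x_init : ∀ i, IsArgmin (P.f i) (x 0 i)
  x_update : ∀ k i, k ∈ T i →
    IsArgmin (fun z => P.f i z +
      ((∑ j ∈ P.nbrs i, inner ℝ (P.g j i z) (y (τ i j k) j) : ℝ) : EReal)) (x (k + 1) i)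
  y_update : ∀ k i, k ∈ T i →
    IsProj (P.Ω i) (y k i + γ i • ∑ j ∈ P.nbrs i, P.g i j (x (τ i j k) j)) (y (k + 1) i)
  x_idle : ∀ k i, k ∉ T i → x (k + 1) i = x k i
  y_idle : ∀ k i, k ∉ T i → y (k + 1) i = y k i

/-- `θ_i`, a Lipschitz constant of all the constraint maps of agent `i` together. -/
def thetaBar (θ : ι → ι → ℝ) (i : ι) : ℝ := Real.sqrt (∑ j ∈ P.nbrs i, θ j i ^ 2)

/-- `φ_i`, the block smoothness constant of the dual function with respect to `y_i`. -/
def phi (ρ : ι → ℝ) (θ : ι → ι → ℝ) (i : ι) : ℝ :=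
  ∑ j ∈ P.nbrs i, P.thetaBar θ j ^ 2 / ρ j

/-- The constant `ℓ_i`. -/
def ell (ρ : ι → ℝ) (θ : ι → ι → ℝ) (i : ι) : ℝ :=
  ∑ j ∈ P.nbrs i, θ i j * (P.thetaBar θ j / ρ j)

/-- The constant `ξ_i`. -/
def xi (ρ : ι → ℝ) (θ : ι → ι → ℝ) (i : ι) : ℝ :=
  ∑ j ∈ P.nbrs i, ∑ l ∈ P.nbrs j, θ l j * (P.thetaBar θ j / ρ j)

end CoupledProblem

end

open scoped BigOperators Topology

noncomputable section

/-! The algorithm is projected gradient ascent on the dual function `D(y) = ∑ j, min_z lag y j z`,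
with outdated gradients. Strong convexity makes the response of agent `j` Lipschitz in the
multipliers, with constant `thetaBar θ j / ρ j` (`response_lipschitz`), and gives `D` a quadratic
lower bound around each point (`lag_ge`).

Each primal iterate is an exact response to multipliers at most `2Q` steps old (`exists_delay`).
Reading it with delay `Q` makes the gradient at most `3Q` steps stale, so its error is controlled by
the dual steps in a window of length `3Q`. Young's inequality charges half of this error to the
current step (through `ell`) and half to the past steps (through `xi`). Since each step lies in at
most `3Q` windows, summation (`telescope_delayed`) gives `D(y 0) + ∑ σ_i ‖step_i‖² ≤ D(y K)`, where
`σ_i > 0` is exactly the margin in the step-size condition.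

The Slater point bounds `D` above, so the steps vanish. Together with full row rank it bounds the
superlevel sets of `D`, so the dual iterates stay bounded. At a cluster point of the multipliers all
delayed copies have the same limit, and the projection inequality passes to the limit as a KKT
condition. KKT and quadratic growth make the response there the unique solution
(`isSolution_of_kkt`). Hence every primal subsequence has a further subsequence tending to the same
point, although the multipliers themselves need not be shown to converge. -/

lemma coe_toReal_of_mem_effDom {E : Type*} {f : E → EReal} (hf : ProperFun f) {x : E} (hx : x ∈ effDom f) :
    (((f x).toReal : ℝ) : EReal) = f x :=
  EReal.coe_toReal (ne_of_lt hx) (hf.1 x)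

/-! ### Strongly convex minimization and projections. -/

section Convex

variable {E : Type*} [NormedAddCommGroup E] [InnerProductSpace ℝ E]

lemma strongConvexOn_add {f : E → EReal} {ρ : ℝ} (hf : StronglyConvexFun ρ f) {q : E → ℝ}
    (hq : ConvexOn ℝ (effDom f) q) :
    StrongConvexOn (effDom f) ρ (fun x => (f x).toReal + q x) := by
  rw [strongConvexOn_iff_convex]
  have h := ConvexOn.add hf hq
  refine h.congr fun x _ => ?_
  simp only [Pi.add_apply]
  ring

lemma IsArgmin.mem_effDom {E : Type*} {f : E → EReal} (hf : ProperFun f) {q : E → ℝ} {z : E}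
    (hz : IsArgmin (fun x => f x + (q x : EReal)) z) : z ∈ effDom f := by
  obtain ⟨w, hw⟩ := hf.2
  by_contra h
  have htop : f z = ⊤ := by simpa [effDom] using h
  have h1 := hz w
  simp only [htop, EReal.top_add_coe, top_le_iff] at h1
  rw [← coe_toReal_of_mem_effDom hf hw, ← EReal.coe_add] at h1
  exact EReal.coe_ne_top _ h1

lemma IsArgmin.le_toReal {E : Type*} {f : E → EReal} (hf : ProperFun f) {q : E → ℝ} {z w : E}
    (hz : IsArgmin (fun x => f x + (q x : EReal)) z) (hw : w ∈ effDom f) :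
    (f z).toReal + q z ≤ (f w).toReal + q w := by
  have h1 := hz w
  simp only at h1
  rw [← coe_toReal_of_mem_effDom hf hw, ← coe_toReal_of_mem_effDom hf (hz.mem_effDom hf)] at h1
  exact_mod_cast h1

/-- Quadratic growth of a strongly convex function around its minimizer. -/
lemma IsArgmin.quadratic_growth {f : E → EReal} (hf : ProperFun f) {ρ : ℝ}
    (hs : StronglyConvexFun ρ f) {q : E → ℝ} (hq : ConvexOn ℝ (effDom f) q) {z w : E}
    (hz : IsArgmin (fun x => f x + (q x : EReal)) z) (hw : w ∈ effDom f) :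
    (f z).toReal + q z + ρ / 2 * ‖w - z‖ ^ 2 ≤ (f w).toReal + q w := by
  have hsc := strongConvexOn_add hs hq
  have hzd := hz.mem_effDom hf
  -- Compare `z` with the point at fraction `t` of the segment from `z` to `w`, divide by `t`, then
  -- let `t → 0`.
  have key : ∀ t : ℝ, t ∈ Set.Ioo (0 : ℝ) 1 →
      (f z).toReal + q z + (1 - t) * (ρ / 2 * ‖w - z‖ ^ 2) ≤ (f w).toReal + q w := by
    rintro t ⟨ht0, ht1⟩
    have h1 := hsc.2 hw hzd ht0.le (sub_nonneg.2 ht1.le) (by ring)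
    have hmem := hsc.1 hw hzd ht0.le (sub_nonneg.2 ht1.le) (by ring)
    have h2 := hz.le_toReal hf hmem
    simp only [smul_eq_mul] at h1
    have h3 := h2.trans h1
    have h4 : 0 ≤ t * ((f w).toReal + q w -
        ((f z).toReal + q z + (1 - t) * (ρ / 2 * ‖w - z‖ ^ 2))) := by linarith
    have := nonneg_of_mul_nonneg_right h4 ht0
    linarith
  have hlim : Filter.Tendsto
      (fun t : ℝ => (f z).toReal + q z + (1 - t) * (ρ / 2 * ‖w - z‖ ^ 2)) (𝓝[>] 0)
      (𝓝 ((f z).toReal + q z + (1 - 0) * (ρ / 2 * ‖w - z‖ ^ 2))) :=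
    (Continuous.tendsto (by fun_prop) 0).mono_left nhdsWithin_le_nhds
  rw [sub_zero, one_mul] at hlim
  refine le_of_tendsto hlim ?_
  filter_upwards [Ioo_mem_nhdsGT (zero_lt_one' ℝ)] with t ht using key t ht

/-- A lower semicontinuous strongly convex function has a minimizer. -/
lemma exists_isArgmin_of_stronglyConvex [FiniteDimensional ℝ E] {F : E → EReal}
    (hF : ProperFun F) (hlsc : LowerSemicontinuous F) {ρ : ℝ} (hρ : 0 < ρ)
    (hs : StronglyConvexFun ρ F) : ∃ z, IsArgmin F z := by
  obtain ⟨x₀, hx₀⟩ := hF.2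
  have hsc := strongConvexOn_add hs (convexOn_const 0 hs.1)
  simp only [add_zero] at hsc
  have : ProperSpace E := FiniteDimensional.proper ℝ E
  have hball : ∀ R : ℝ, 0 ≤ R → ∃ z ∈ Metric.closedBall x₀ R, z ∈ effDom F ∧
      ∀ w ∈ Metric.closedBall x₀ R, F z ≤ F w := by
    intro R hR
    obtain ⟨z, hz, hmin⟩ := LowerSemicontinuousOn.exists_isMinOn
      ⟨x₀, Metric.mem_closedBall_self hR⟩ (isCompact_closedBall x₀ R)
      (hlsc.lowerSemicontinuousOn _)
    exact ⟨z, hz, show F z < ⊤ from lt_of_le_of_lt (hmin (Metric.mem_closedBall_self hR)) hx₀, fun w hw => hmin hw⟩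
  obtain ⟨z₁, -, hz₁, hmin₁⟩ := hball 1 zero_le_one
  set m := (F z₁).toReal
  set v := (F x₀).toReal
  have hm : ∀ w ∈ Metric.closedBall x₀ 1, w ∈ effDom F → m ≤ (F w).toReal := fun w hw hd => by
    have := hmin₁ w hw
    rw [← coe_toReal_of_mem_effDom hF hd, ← coe_toReal_of_mem_effDom hF hz₁] at this
    exact_mod_cast this
  have hmv : m ≤ v := hm _ (Metric.mem_closedBall_self zero_le_one) hx₀
  -- Beyond this radius, strong convexity on the segment from `x₀` to `w`, evaluated where it meets
  -- the unit sphere (value at least `m`), forces `F w ≥ v`. So minimizing on the ball of radius `R`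
  -- suffices.
  set R := 1 + 2 * (v - m) / ρ
  have hR1 : 1 ≤ R := by
    have : 0 ≤ 2 * (v - m) / ρ := div_nonneg (by linarith) hρ.le
    linarith
  obtain ⟨z, -, hz, hmin⟩ := hball R (by linarith)
  refine ⟨z, fun w => ?_⟩
  by_cases hw : w ∈ Metric.closedBall x₀ R
  · exact hmin w hw
  refine (hmin x₀ (Metric.mem_closedBall_self (by linarith))).trans ?_
  by_cases hwd : w ∈ effDom F
  swap
  · have : F w = ⊤ := by simpa [effDom] using hwd
    rw [this]; exact le_top
  set r := ‖w - x₀‖ with hr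
  have hRr : R < r := by simpa [dist_eq_norm] using hw
  have hr1 : 1 < r := by linarith
  have hr0 : 0 < r := by linarith
  have ht0 : 0 ≤ r⁻¹ := by positivity
  have ht1 : 0 ≤ 1 - r⁻¹ := sub_nonneg.2 (inv_le_one_of_one_le₀ hr1.le)
  have h1 := hsc.2 hwd hx₀ ht0 ht1 (by ring)
  have hmem := hsc.1 hwd hx₀ ht0 ht1 (by ring)
  have h2 : r⁻¹ • w + (1 - r⁻¹) • x₀ ∈ Metric.closedBall x₀ 1 := by
    rw [Metric.mem_closedBall, dist_eq_norm]
    have : r⁻¹ • w + (1 - r⁻¹) • x₀ - x₀ = r⁻¹ • (w - x₀) := by module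
    rw [this, norm_smul, Real.norm_of_nonneg ht0, ← hr, inv_mul_cancel₀ hr0.ne']
  have h3 := hm _ h2 hmem
  simp only [smul_eq_mul, ← hr] at h1
  have h4 : m * r ≤ (F w).toReal + (r - 1) * v - (r - 1) * (ρ / 2) * r := by
    have h5 := mul_le_mul_of_nonneg_right (h3.trans h1) hr0.le
    calc m * r ≤ _ := h5
      _ = _ := by
        change (r⁻¹ * (F w).toReal + (1 - r⁻¹) * v - r⁻¹ * (1 - r⁻¹) * (ρ / 2 * r ^ 2)) * r = _
        field_simp
  have h6 : v - m ≤ (r - 1) * (ρ / 2) := by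
    have : 2 * (v - m) / ρ < r - 1 := by linarith
    rw [div_lt_iff₀ hρ] at this
    linarith
  have h7 : v ≤ (F w).toReal := by nlinarith
  rw [← coe_toReal_of_mem_effDom hF hwd, ← coe_toReal_of_mem_effDom hF hx₀]
  exact_mod_cast h7

/-- A lower semicontinuous strongly convex function plus a function which is convex and Lipschitz
on its effective domain has a minimizer. -/
lemma exists_isArgmin_add [FiniteDimensional ℝ E] {f : E → EReal}
    (hf : ProperFun f) (hlsc : LowerSemicontinuous f) {ρ : ℝ} (hρ : 0 < ρ)
    (hs : StronglyConvexFun ρ f) {q : E → ℝ} (hq : ConvexOn ℝ (effDom f) q) {K : NNReal}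
    (hK : LipschitzOnWith K q (effDom f)) :
    ∃ z, IsArgmin (fun x => f x + (q x : EReal)) z := by
  -- Off the domain `q` may be discontinuous, but `f = ⊤` hides it there; a Lipschitz extension
  -- restores lower semicontinuity of the sum.
  obtain ⟨q', hq', heq⟩ := hK.extend_real
  have hFq : (fun x => f x + (q x : EReal)) = fun x => f x + (q' x : EReal) := by
    funext x
    by_cases hx : x ∈ effDom f
    · rw [heq hx]
    · have : f x = ⊤ := by simpa [effDom] using hx
      rw [this, EReal.top_add_coe, EReal.top_add_coe]
  have hdom : effDom (fun x => f x + (q x : EReal)) = effDom f := by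
    ext x
    simp only [effDom, Set.mem_ofPred_eq, lt_top_iff_ne_top, ne_eq]
    rw [not_iff_not]
    constructor
    · intro h
      by_contra hne
      exact (EReal.add_lt_top hne (EReal.coe_ne_top _)).ne h
    · intro h
      rw [h, EReal.top_add_coe]
  refine exists_isArgmin_of_stronglyConvex (ρ := ρ) ⟨fun x => ?_, ?_⟩ ?_ hρ ?_
  · simp [EReal.add_eq_bot_iff, hf.1 x]
  · rw [hdom]; exact hf.2
  · rw [hFq]
    refine hlsc.add' (Continuous.lowerSemicontinuous
      (continuous_coe_real_ereal.comp hq'.continuous)) fun x => ?_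
    exact EReal.continuousAt_add (Or.inr (EReal.coe_ne_bot _)) (Or.inr (EReal.coe_ne_top _))
  · rw [StronglyConvexFun, hdom]
    have h := strongConvexOn_iff_convex.1 (strongConvexOn_add hs hq)
    refine h.congr fun x hx => ?_
    simp only
    rw [EReal.toReal_add (ne_of_lt hx) (hf.1 x) (EReal.coe_ne_top _) (EReal.coe_ne_bot _),
      EReal.toReal_coe]

lemma IsProj.inner_le_zero {S : Set E} (hS : Convex ℝ S) {u v : E} (h : IsProj S u v) :
    ∀ w ∈ S, inner ℝ (u - v) (w - v) ≤ 0 := by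
  rw [← norm_eq_iInf_iff_real_inner_le_zero hS h.1]
  have : Nonempty S := ⟨⟨v, h.1⟩⟩
  refine le_antisymm (le_ciInf fun w => h.2 w w.2) ?_
  exact ciInf_le (f := fun w : S => ‖u - w‖) ⟨0, Set.forall_mem_range.2 fun _ => norm_nonneg _⟩
    ⟨v, h.1⟩

lemma exists_isProj [CompleteSpace E] {S : Set E} (hne : S.Nonempty) (hS : Convex ℝ S)
    (hc : IsClosed S) (u : E) : ∃ v, IsProj S u v := by
  obtain ⟨v, hv, h⟩ := exists_norm_eq_iInf_of_complete_convex hne hc.isComplete hS u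
  refine ⟨v, hv, fun w hw => ?_⟩
  rw [h]
  exact ciInf_le (f := fun w : S => ‖u - w‖) ⟨0, Set.forall_mem_range.2 fun _ => norm_nonneg _⟩
    ⟨w, hw⟩

end Convex

/-! ### Sequences with vanishing steps. -/

section Sequences

lemma tendsto_dist_of_bounded_shift {E : Type*} [PseudoMetricSpace E] {v : ℕ → E}
    (hv : Filter.Tendsto (fun k => dist (v k) (v (k + 1))) Filter.atTop (𝓝 0)) (B : ℕ)
    {m n : ℕ → ℕ} (hn : Filter.Tendsto n Filter.atTop Filter.atTop)
    (hmn : ∀ k, m k ≤ n k + B) (hnm : ∀ k, n k ≤ m k + B) :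
    Filter.Tendsto (fun k => dist (v (m k)) (v (n k))) Filter.atTop (𝓝 0) := by
  have hsum : Filter.Tendsto (fun k => ∑ b ∈ Finset.range (2 * B),
      dist (v (n k - B + b)) (v (n k - B + b + 1))) Filter.atTop (𝓝 0) := by
    have h : ∀ b ∈ Finset.range (2 * B), Filter.Tendsto
        (fun k => dist (v (n k - B + b)) (v (n k - B + b + 1))) Filter.atTop (𝓝 0) :=
      fun b _ => hv.comp (Filter.tendsto_atTop_mono (fun _ => Nat.le_add_right _ b)
        ((Filter.tendsto_sub_atTop_nat B).comp hn))
    simpa using tendsto_finsetSum _ h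
  refine squeeze_zero (fun _ => dist_nonneg) (fun k => ?_) hsum
  -- Both indices lie in the window of `2 * B` steps starting at `n k - B`, even when the
  -- subtraction truncates.
  have hle : ∀ a b, a ≤ b → n k - B ≤ a → b ≤ n k - B + 2 * B → dist (v a) (v b) ≤
      ∑ b ∈ Finset.range (2 * B), dist (v (n k - B + b)) (v (n k - B + b + 1)) := by
    intro a b hab ha hb
    have h := Finset.sum_Ico_eq_sum_range (fun b => dist (v b) (v (b + 1)))
      (n k - B) (n k - B + 2 * B)
    rw [Nat.add_sub_cancel_left] at h
    rw [← h]
    exact (dist_le_Ico_sum_dist v hab).trans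
      (Finset.sum_le_sum_of_subset_of_nonneg (Finset.Ico_subset_Ico ha hb)
        fun _ _ _ => dist_nonneg)
  have h1 := hmn k
  have h2 := hnm k
  rcases le_total (m k) (n k) with h | h
  · exact hle _ _ h (by omega) (by omega)
  · rw [dist_comm]
    exact hle _ _ h (by omega) (by omega)

end Sequences

/-! ### Responses to multipliers and smoothness of the dual function. -/

namespace CoupledProblem

variable {ι : Type*} (P : CoupledProblem ι)

lemma convex_Ω (i : ι) : Convex ℝ (P.Ω i) := by
  intro x hx y hy a b ha hb _ s
  have h1 := hx s
  have h2 := hy s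
  simp only [PiLp.add_apply, PiLp.smul_apply, smul_eq_mul]
  positivity

lemma isClosed_Ω (i : ι) : IsClosed (P.Ω i) := by
  have : P.Ω i = ⋂ s : Fin (P.p i), {y | 0 ≤ y (Sum.inl s)} := by
    ext y
    simp [Ω]
  rw [this]
  exact isClosed_iInter fun s => isClosed_le continuous_const (by fun_prop)

lemma zero_mem_Ω (i : ι) : (0 : P.DualBlock i) ∈ P.Ω i := fun _ => by simp

lemma inner_g (i j : ι) (z : EuclideanSpace ℝ (Fin (P.n j))) (v : P.DualBlock i) :
    inner ℝ (P.g i j z) v = ∑ s, v s * P.g i j z s := by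
  simp [PiLp.inner_apply]

lemma a_affine (i j : ι) {x z : EuclideanSpace ℝ (Fin (P.n j))} {s t : ℝ} (h : s + t = 1) :
    P.a i j (s • x + t • z) = s • P.a i j x + t • P.a i j z := by
  have hb : P.b i j = s • P.b i j + t • P.b i j := by rw [← add_smul, h, one_smul]
  simp only [a, WithLp.ofLp_add, WithLp.ofLp_smul, Matrix.mulVec_add, Matrix.mulVec_smul,
    WithLp.toLp_add, WithLp.toLp_smul]
  nth_rw 1 [hb]
  module

variable [Fintype ι]

lemma mem_nbrs_comm {i j : ι} : j ∈ P.nbrs i ↔ i ∈ P.nbrs j := by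
  simp only [nbrs, Finset.mem_filter, Finset.mem_univ, true_and, P.G.adj_comm i j, eq_comm]

lemma sum_nbrs_comm {M : Type*} [AddCommMonoid M] (F : ι → ι → M) :
    ∑ i, ∑ j ∈ P.nbrs i, F i j = ∑ j, ∑ i ∈ P.nbrs j, F i j := by
  apply Finset.sum_comm'
  intro i j
  simp [P.mem_nbrs_comm (i := i)]

/-- The coupling part of the Lagrangian that involves the decision of agent `j`. -/
def pen (y : P.Dual) (j : ι) (z : EuclideanSpace ℝ (Fin (P.n j))) : ℝ :=
  ∑ i ∈ P.nbrs j, inner ℝ (P.g i j z) (y i)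

/-- `z` minimizes the part of the Lagrangian at `y` that involves the decision of agent `j`. -/
def IsResponse (y : P.Dual) (j : ι) (z : EuclideanSpace ℝ (Fin (P.n j))) : Prop :=
  IsArgmin (fun w => P.f j w + (P.pen y j w : EReal)) z

/-- The value at `z` of the part of the Lagrangian at `y` that involves the decision of
agent `j`. -/
def lag (y : P.Dual) (j : ι) (z : EuclideanSpace ℝ (Fin (P.n j))) : ℝ :=
  (P.f j z).toReal + P.pen y j z

lemma pen_sub (y y' : P.Dual) (j : ι) (z : EuclideanSpace ℝ (Fin (P.n j))) :
    P.pen y' j z - P.pen y j z = ∑ i ∈ P.nbrs j, inner ℝ (P.g i j z) (y' i - y i) := by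
  simp only [pen, inner_sub_right, Finset.sum_sub_distrib]

lemma sum_theta_mul_le (θ : ι → ι → ℝ) (j : ι) (e : ι → ℝ) :
    (∑ i ∈ P.nbrs j, θ i j * e i) ^ 2 ≤ P.thetaBar θ j ^ 2 * ∑ i ∈ P.nbrs j, e i ^ 2 := by
  rw [thetaBar, Real.sq_sqrt (Finset.sum_nonneg fun _ _ => sq_nonneg _)]
  exact Finset.sum_mul_sq_le_sq_mul_sq _ _ _

namespace Regular

variable {P} {ρ : ι → ℝ} {θ : ι → ι → ℝ} (hP : P.Regular ρ θ)
include hP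

/-- Nonnegative weights preserve convexity of the inequality components; the equality components are
affine, so their multipliers may have any sign. -/
lemma convexOn_pen {y : P.Dual} (hy : ∀ i, y i ∈ P.Ω i) (j : ι) :
    ConvexOn ℝ (effDom (P.f j)) (P.pen y j) := by
  have hconv : Convex ℝ (effDom (P.f j)) := (hP.strongly_convex j).1
  refine ⟨hconv, fun x hx z hz a b ha hb hab => ?_⟩
  simp only [pen, smul_eq_mul, Finset.mul_sum, ← Finset.sum_add_distrib, inner_g]
  refine Finset.sum_le_sum fun i hi => Finset.sum_le_sum fun s _ => ?_
  rcases s with s | s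
  · have h1 := (hP.convex i j (P.mem_nbrs_comm.1 hi) (Sum.inl s)).2 hx hz ha hb hab
    simp only [smul_eq_mul] at h1
    have := mul_le_mul_of_nonneg_left h1 (hy i s)
    linarith
  · have h1 : P.g i j (a • x + b • z) (Sum.inr s) =
        a * P.g i j x (Sum.inr s) + b * P.g i j z (Sum.inr s) := by
      simp [g, P.a_affine i j hab]
    rw [h1]
    linarith

lemma abs_sum_inner_le (j : ι) {x z : EuclideanSpace ℝ (Fin (P.n j))} (hx : x ∈ effDom (P.f j))
    (hz : z ∈ effDom (P.f j)) (v : P.Dual) :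
    |∑ i ∈ P.nbrs j, inner ℝ (P.g i j x - P.g i j z) (v i)| ≤
      (∑ i ∈ P.nbrs j, θ i j * ‖v i‖) * ‖x - z‖ := by
  refine (Finset.abs_sum_le_sum_abs _ _).trans ?_
  rw [Finset.sum_mul]
  refine Finset.sum_le_sum fun i hi => ?_
  refine (abs_real_inner_le_norm _ _).trans ?_
  have := hP.lipschitz i j (P.mem_nbrs_comm.1 hi) x hx z hz
  calc _ ≤ θ i j * ‖x - z‖ * ‖v i‖ := by gcongr
    _ = _ := by ring

lemma lipschitzOn_pen (y : P.Dual) (j : ι) :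
    ∃ K : NNReal, LipschitzOnWith K (P.pen y j) (effDom (P.f j)) := by
  refine ⟨Real.toNNReal (∑ i ∈ P.nbrs j, θ i j * ‖y i‖), ?_⟩
  rw [lipschitzOnWith_iff_norm_sub_le]
  intro x hx z hz
  have h := hP.abs_sum_inner_le j hx hz y
  simp only [inner_sub_left, Finset.sum_sub_distrib] at h
  rw [Real.norm_eq_abs]
  refine h.trans ?_
  gcongr
  exact Real.le_coe_toNNReal _

lemma exists_isResponse {y : P.Dual} (hy : ∀ i, y i ∈ P.Ω i) (j : ι) :
    ∃ z, P.IsResponse y j z := by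
  obtain ⟨K, hK⟩ := hP.lipschitzOn_pen y j
  exact exists_isArgmin_add (hP.proper j) (hP.closed j) (hP.rho_pos j) (hP.strongly_convex j)
    (hP.convexOn_pen hy j) hK

lemma mem_effDom {y : P.Dual} {j : ι} {z : EuclideanSpace ℝ (Fin (P.n j))}
    (hz : P.IsResponse y j z) : z ∈ effDom (P.f j) :=
  IsArgmin.mem_effDom (hP.proper j) hz

lemma quadratic_growth {y : P.Dual} (hy : ∀ i, y i ∈ P.Ω i) {j : ι}
    {z w : EuclideanSpace ℝ (Fin (P.n j))} (hz : P.IsResponse y j z) (hw : w ∈ effDom (P.f j)) :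
    P.lag y j z + ρ j / 2 * ‖w - z‖ ^ 2 ≤ P.lag y j w :=
  IsArgmin.quadratic_growth (hP.proper j) (hP.strongly_convex j) (hP.convexOn_pen hy j) hz hw

/-- The response of an agent is a Lipschitz function of the multipliers. -/
lemma response_lipschitz {y y' : P.Dual} (hy : ∀ i, y i ∈ P.Ω i) (hy' : ∀ i, y' i ∈ P.Ω i) {j : ι}
    {z z' : EuclideanSpace ℝ (Fin (P.n j))} (hz : P.IsResponse y j z)
    (hz' : P.IsResponse y' j z') :
    ρ j * ‖z' - z‖ ≤ ∑ i ∈ P.nbrs j, θ i j * ‖y' i - y i‖ := by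
  -- Adding the two growth inequalities cancels the costs and leaves `ρ d² ≤ S d`, with `d = ‖z' -
  -- z‖` and `S` the right-hand side.
  have h1 := hP.quadratic_growth hy hz (hP.mem_effDom hz')
  have h2 := hP.quadratic_growth hy' hz' (hP.mem_effDom hz)
  have h3 := hP.abs_sum_inner_le j (hP.mem_effDom hz) (hP.mem_effDom hz') (fun i => y' i - y i)
  simp only [inner_sub_left, Finset.sum_sub_distrib] at h3
  rw [← pen_sub, ← pen_sub] at h3
  have h4 := le_of_abs_le h3
  rw [norm_sub_rev z z'] at h2 h4
  simp only [lag] at h1 h2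
  by_contra! hlt
  have h0 : 0 ≤ ∑ i ∈ P.nbrs j, θ i j * ‖y' i - y i‖ := Finset.sum_nonneg fun i hi =>
    mul_nonneg (hP.theta_pos i j (P.mem_nbrs_comm.1 hi)).le (norm_nonneg _)
  have hpos : 0 < ‖z' - z‖ := by
    by_contra h
    have : ‖z' - z‖ = 0 := le_antisymm (not_lt.1 h) (norm_nonneg _)
    rw [this] at hlt
    linarith
  have := mul_lt_mul_of_pos_right hlt hpos
  nlinarith

/-- One half of the smoothness of the dual function of agent `j`. -/
lemma lag_ge {y y' : P.Dual} (hy : ∀ i, y i ∈ P.Ω i) {j : ι}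
    {z z' : EuclideanSpace ℝ (Fin (P.n j))} (hz : P.IsResponse y j z)
    (hz' : P.IsResponse y' j z') :
    P.lag y j z + ∑ i ∈ P.nbrs j, inner ℝ (P.g i j z) (y' i - y i) -
      P.thetaBar θ j ^ 2 / ρ j / 2 * ∑ i ∈ P.nbrs j, ‖y' i - y i‖ ^ 2 ≤ P.lag y' j z' := by
  have h1 := hP.quadratic_growth hy hz (hP.mem_effDom hz')
  have h3 := hP.abs_sum_inner_le j (hP.mem_effDom hz) (hP.mem_effDom hz') (fun i => y' i - y i)
  simp only [inner_sub_left, Finset.sum_sub_distrib] at h3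
  have h4 := le_of_abs_le h3
  rw [norm_sub_rev z z'] at h4
  have h5 := P.pen_sub y y' j z'
  have h6 := P.sum_theta_mul_le θ j (fun i => ‖y' i - y i‖)
  have hρ := hP.rho_pos j
  set S := ∑ i ∈ P.nbrs j, θ i j * ‖y' i - y i‖
  set d := ‖z' - z‖
  -- The growth term at `z'` absorbs the change of the constraint maps between `z` and `z'`, by
  -- Young's inequality.
  have h7 : S * d ≤ ρ j / 2 * d ^ 2 + S ^ 2 / ρ j / 2 := by
    have : 0 ≤ (ρ j * d - S) ^ 2 / ρ j / 2 := by positivity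
    have e : (ρ j * d - S) ^ 2 / ρ j / 2 = ρ j / 2 * d ^ 2 + S ^ 2 / ρ j / 2 - S * d := by
      field_simp
      ring
    linarith
  have h8 : S ^ 2 / ρ j / 2 ≤ P.thetaBar θ j ^ 2 / ρ j / 2 * ∑ i ∈ P.nbrs j, ‖y' i - y i‖ ^ 2 := by
    calc S ^ 2 / ρ j / 2 ≤ (P.thetaBar θ j ^ 2 * ∑ i ∈ P.nbrs j, ‖y' i - y i‖ ^ 2) / ρ j / 2 := by
          gcongr
      _ = _ := by ring
  simp only [lag] at h1 ⊢
  linarith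

end Regular

end CoupledProblem

/-- Since `⊤ + ⊥ = ⊥`, a sum below `⊤` says nothing about its terms unless none is `⊥`; the
induction for the second claim needs the first. -/
lemma EReal.sum_ne_bot_and_lt_top {α : Type*} {u : α → EReal} (s : Finset α)
    (h : ∀ i ∈ s, u i ≠ ⊥) : ∑ i ∈ s, u i ≠ ⊥ ∧ (∑ i ∈ s, u i < ⊤ → ∀ i ∈ s, u i < ⊤) := by
  classical
  induction s using Finset.induction_on with
  | empty => simp
  | insert a s ha ih =>
    obtain ⟨h1, h2⟩ := ih fun i hi => h i (Finset.mem_insert_of_mem hi)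
    have h3 := h a (Finset.mem_insert_self a s)
    rw [Finset.sum_insert ha]
    refine ⟨fun hbot => ?_, fun htop => ?_⟩
    · rcases EReal.add_eq_bot_iff.1 hbot with h4 | h4
      · exact h3 h4
      · exact h1 h4
    · have ha' : u a < ⊤ := by
        by_contra h4
        rw [not_lt_top_iff.1 h4, EReal.top_add_of_ne_bot h1] at htop
        exact lt_irrefl _ htop
      have hs' : ∑ i ∈ s, u i < ⊤ := by
        by_contra h4
        rw [not_lt_top_iff.1 h4, EReal.add_top_of_ne_bot h3] at htop
        exact lt_irrefl _ htop
      intro i hi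
      rcases Finset.mem_insert.1 hi with rfl | hi
      · exact ha'
      · exact h2 hs' i hi

lemma EuclideanSpace.norm_le_sum_abs {α : Type*} [Fintype α] (v : EuclideanSpace ℝ α) :
    ‖v‖ ≤ ∑ s, |v s| := by
  rw [EuclideanSpace.norm_eq]
  refine Real.sqrt_le_iff.2 ⟨Finset.sum_nonneg fun _ _ => abs_nonneg _, ?_⟩
  exact Finset.sum_sq_le_sq_sum_of_nonneg fun _ _ => abs_nonneg _

lemma Matrix.mulVec_surjective_of_linearIndependent_row {m n : Type*} [Fintype m] [Fintype n]
    {M : Matrix m n ℝ} (h : LinearIndependent ℝ M.row) : Function.Surjective M.mulVec := by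
  have h1 : Module.finrank ℝ (LinearMap.range M.mulVecLin) = Module.finrank ℝ (m → ℝ) := by
    rw [Module.finrank_fintype_fun_eq_card]
    exact h.rank_matrix
  exact LinearMap.range_eq_top.1 (Submodule.eq_top_of_finrank_eq h1)

/-! ### Optimality conditions and bounded dual superlevel sets. -/

namespace CoupledProblem

variable {ι : Type*} (P : CoupledProblem ι) [Fintype ι]

/-- The value of the constraint maps of agent `i`. -/
def total (z : P.Primal) (i : ι) : P.DualBlock i := ∑ j ∈ P.nbrs i, P.g i j (z j)

lemma total_inl (z : P.Primal) (i : ι) (s : Fin (P.p i)) :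
    P.total z i (Sum.inl s) = ∑ j ∈ P.nbrs i, P.c i j (z j) s := by
  simp [total, g]

lemma total_inr (z : P.Primal) (i : ι) (t : Fin (P.r i)) :
    P.total z i (Sum.inr t) = (∑ j ∈ P.nbrs i, P.a i j (z j)) t := by
  simp [total, g]

lemma sum_pen (y : P.Dual) (z : P.Primal) :
    ∑ j, P.pen y j (z j) = ∑ i, inner ℝ (P.total z i) (y i) := by
  simp only [pen, total, sum_inner]
  exact P.sum_nbrs_comm fun j i => inner ℝ (P.g i j (z j)) (y i)

lemma sum_lag (y : P.Dual) (z : P.Primal) :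
    ∑ j, P.lag y j (z j) = ∑ j, (P.f j (z j)).toReal + ∑ i, inner ℝ (P.total z i) (y i) := by
  rw [← sum_pen, ← Finset.sum_add_distrib]
  rfl

lemma inner_total (z : P.Primal) (i : ι) (v : P.DualBlock i) :
    inner ℝ (P.total z i) v = ∑ s, v (Sum.inl s) * P.total z i (Sum.inl s) +
      ∑ t, v (Sum.inr t) * P.total z i (Sum.inr t) := by
  simp [PiLp.inner_apply]

lemma inner_total_of_eq {z : P.Primal} {i : ι} (h : ∀ t, P.total z i (Sum.inr t) = 0)
    (v : P.DualBlock i) :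
    inner ℝ (P.total z i) v = ∑ s, v (Sum.inl s) * P.total z i (Sum.inl s) := by
  simp [inner_total, h]

lemma mem_feasible_iff (z : P.Primal) : z ∈ P.feasible ↔
    ∀ i, (∀ s, P.total z i (Sum.inl s) ≤ 0) ∧ ∀ t, P.total z i (Sum.inr t) = 0 := by
  simp only [total_inl, total_inr]
  refine forall_congr' fun i => and_congr Iff.rfl ?_
  refine ⟨fun h t => by rw [h]; rfl, fun h => ?_⟩
  ext t
  exact h t

namespace Regular

variable {P} {ρ : ι → ℝ} {θ : ι → ι → ℝ} (hP : P.Regular ρ θ)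
include hP

lemma cost_eq {z : P.Primal} (hz : ∀ j, z j ∈ effDom (P.f j)) :
    P.cost z = ((∑ j, (P.f j (z j)).toReal : ℝ) : EReal) := by
  have h : ∀ s : Finset ι, ∑ j ∈ s, P.f j (z j) =
      ((∑ j ∈ s, (P.f j (z j)).toReal : ℝ) : EReal) := by
    classical
    intro s
    induction s using Finset.induction_on with
    | empty => simp
    | insert a s ha ih =>
      rw [Finset.sum_insert ha, Finset.sum_insert ha, ih, EReal.coe_add,
        coe_toReal_of_mem_effDom (hP.proper a) (hz a)]
  exact h _

lemma mem_effDom_cost_iff {z : P.Primal} :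
    z ∈ effDom P.cost ↔ ∀ j, z j ∈ effDom (P.f j) := by
  constructor
  · intro h j
    exact (EReal.sum_ne_bot_and_lt_top Finset.univ fun i _ => (hP.proper i).1 (z i)).2 h j
      (Finset.mem_univ j)
  · intro h
    show P.cost z < ⊤
    rw [hP.cost_eq h]
    exact EReal.coe_lt_top _

lemma continuousOn_g {i j : ι} (hj : j ∈ P.nbrs i) : ContinuousOn (P.g i j) (effDom (P.f j)) := by
  have : LipschitzOnWith (Real.toNNReal (θ i j)) (P.g i j) (effDom (P.f j)) := by
    rw [lipschitzOnWith_iff_norm_sub_le]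
    intro x hx z hz
    rw [Real.coe_toNNReal _ (hP.theta_pos i j hj).le]
    exact hP.lipschitz i j hj x hx z hz
  exact this.continuousOn

/-- A primal-dual pair satisfying the optimality conditions gives the unique solution. -/
lemma isSolution_of_kkt {y : P.Dual} (hy : ∀ i, y i ∈ P.Ω i) {x : P.Primal}
    (hx : ∀ j, P.IsResponse y j (x j))
    (hvi : ∀ i, ∀ w ∈ P.Ω i, inner ℝ (P.total x i) (w - y i) ≤ 0) :
    P.IsSolution x ∧ ∀ z, P.IsSolution z → z = x := by
  classical
  have hxd : ∀ j, x j ∈ effDom (P.f j) := fun j => hP.mem_effDom (hx j)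
  have hcompl : ∀ i, inner ℝ (P.total x i) (y i) = 0 := fun i => by
    -- Complementary slackness: testing with `0` and `2 y` gives both signs.
    have h1 := hvi i 0 (P.zero_mem_Ω i)
    have h2 := hvi i ((2 : ℝ) • y i) fun s => by
      have := hy i s
      simp only [PiLp.smul_apply, smul_eq_mul]
      positivity
    have e : (2 : ℝ) • y i - y i = y i := by module
    rw [zero_sub, inner_neg_right] at h1
    rw [e] at h2
    linarith
  have hfeas : x ∈ P.feasible := by
    rw [mem_feasible_iff]
    have hadd : ∀ i, ∀ v, y i + v ∈ P.Ω i → inner ℝ (P.total x i) v ≤ 0 := fun i v hv => by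
      simpa using hvi i (y i + v) hv
    refine fun i => ⟨fun s => ?_, fun t => ?_⟩
    · have := hadd i (EuclideanSpace.single (Sum.inl s) 1) fun s' => by
        have h1 := hy i s'
        simp only [PiLp.add_apply, PiLp.single_apply]
        split_ifs <;> linarith
      rwa [EuclideanSpace.inner_single_right, one_mul, conj_trivial] at this
    · have h1 := hadd i (EuclideanSpace.single (Sum.inr t) 1) fun s' => by
        have h1 := hy i s'
        simpa using h1
      have h2 := hadd i (EuclideanSpace.single (Sum.inr t) (-1)) fun s' => by
        have h1 := hy i s'
        simpa using h1
      rw [EuclideanSpace.inner_single_right, conj_trivial] at h1 h2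
      linarith
  have hgrow : ∀ z ∈ P.feasible, (∀ j, z j ∈ effDom (P.f j)) →
      ∑ j, (P.f j (x j)).toReal + ∑ j, ρ j / 2 * ‖z j - x j‖ ^ 2 ≤
        ∑ j, (P.f j (z j)).toReal := by
    intro z hz hzd
    have h1 := Finset.sum_le_sum fun j (_ : j ∈ Finset.univ) =>
      hP.quadratic_growth hy (hx j) (hzd j)
    rw [Finset.sum_add_distrib, sum_lag, sum_lag, Finset.sum_congr rfl fun i _ => hcompl i,
      Finset.sum_const_zero] at h1
    have h2 : ∑ i, inner ℝ (P.total z i) (y i) ≤ 0 := Finset.sum_nonpos fun i _ => by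
      rw [mem_feasible_iff] at hz
      rw [P.inner_total_of_eq (hz i).2]
      exact Finset.sum_nonpos fun s _ => mul_nonpos_of_nonneg_of_nonpos (hy i s) ((hz i).1 s)
    linarith
  have hnn : ∀ z : P.Primal, ∀ j ∈ Finset.univ, 0 ≤ ρ j / 2 * ‖z j - x j‖ ^ 2 := fun z j _ => by
    have := hP.rho_pos j
    positivity
  have hle : ∀ z ∈ P.feasible, P.cost x ≤ P.cost z := fun z hz => by
    by_cases hzc : z ∈ effDom P.cost
    · have hzd := hP.mem_effDom_cost_iff.1 hzc
      rw [hP.cost_eq hxd, hP.cost_eq hzd, EReal.coe_le_coe_iff]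
      have := hgrow z hz hzd
      have := Finset.sum_nonneg (hnn z)
      linarith
    · have : P.cost z = ⊤ := by simpa [effDom] using hzc
      rw [this]
      exact le_top
  refine ⟨⟨hfeas, hle⟩, fun z hz => ?_⟩
  have h1 := hz.2 x hfeas
  have hzd := hP.mem_effDom_cost_iff.1 (h1.trans_lt (hP.mem_effDom_cost_iff.2 hxd))
  rw [hP.cost_eq hxd, hP.cost_eq hzd, EReal.coe_le_coe_iff] at h1
  have h2 := hgrow z hz.1 hzd
  have h3 : ∑ j, ρ j / 2 * ‖z j - x j‖ ^ 2 = 0 :=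
    le_antisymm (by linarith) (Finset.sum_nonneg (hnn z))
  funext j
  have h4 := (Finset.sum_eq_zero_iff_of_nonneg (hnn z)).1 h3 j (Finset.mem_univ j)
  have h5 := hP.rho_pos j
  have h6 : ‖z j - x j‖ = 0 := by
    rcases mul_eq_zero.1 h4 with h | h
    · linarith
    · exact pow_eq_zero_iff two_ne_zero |>.1 h
  exact sub_eq_zero.1 (norm_eq_zero.1 h6)

/-- The equality constraints can be perturbed in every direction. -/
lemma exists_perturbation (v : ∀ i, Fin (P.r i) → ℝ) : ∃ z : P.Primal, ∃ ε : ℝ, 0 < ε ∧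
    (∀ j, z j ∈ effDom (P.f j)) ∧
    ∀ i, (∀ s, P.total z i (Sum.inl s) < 0) ∧ ∀ t, P.total z i (Sum.inr t) = ε * v i t := by
  classical
  obtain ⟨x, hx, hxc⟩ := hP.slater
  -- Solve `A d = v` and move from the Slater point by `ε d`: the equality residual becomes `ε v`,
  -- while the domain and the strict inequalities survive for small `ε`.
  obtain ⟨d₀, hd₀⟩ := Matrix.mulVec_surjective_of_linearIndependent_row hP.full_row_rank
    (fun t => v t.1 t.2)
  let d : P.Primal := fun j => WithLp.toLp 2 fun t => d₀ ⟨j, t⟩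
  let path : ℝ → P.Primal := fun ε => x + ε • d
  have hpath : Continuous path := by fun_prop
  have hpath0 : path 0 = x := by simp [path]
  have hdom : ∀ᶠ ε in 𝓝 (0 : ℝ), ∀ j, path ε j ∈ effDom (P.f j) := by
    have h1 : Filter.Tendsto path (𝓝 0) (𝓝 x) := by
      have := hpath.tendsto 0
      rwa [hpath0] at this
    filter_upwards [h1 (mem_interior_iff_mem_nhds.1 hx)] with ε hε
    exact hP.mem_effDom_cost_iff.1 hε
  have hxd : ∀ j, x j ∈ effDom (P.f j) := hP.mem_effDom_cost_iff.1 (interior_subset hx)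
  have htot : ∀ i, Filter.Tendsto (fun ε => P.total (path ε) i) (𝓝 0) (𝓝 (P.total x i)) := by
    refine fun i => tendsto_finsetSum _ fun j hj => ?_
    refine (hP.continuousOn_g hj (x j) (hxd j)).tendsto.comp
      (tendsto_nhdsWithin_iff.2 ⟨?_, hdom.mono fun ε h => h j⟩)
    have h1 : Continuous fun ε => path ε j := by fun_prop
    have := h1.tendsto 0
    rwa [hpath0] at this
  have hineq : ∀ᶠ ε in 𝓝 (0 : ℝ), ∀ i, ∀ s, P.total (path ε) i (Sum.inl s) < 0 := by
    rw [Filter.eventually_all]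
    intro i
    rw [Filter.eventually_all]
    intro s
    have h1 : Filter.Tendsto (fun ε => P.total (path ε) i (Sum.inl s)) (𝓝 0)
        (𝓝 (P.total x i (Sum.inl s))) :=
      (Continuous.tendsto (by fun_prop : Continuous fun w : P.DualBlock i => w (Sum.inl s))
        _).comp (htot i)
    refine h1.eventually_lt_const ?_
    rw [total_inl]
    exact (hxc i).1 s
  have hgt : ∀ᶠ ε in 𝓝[>] (0 : ℝ), 0 < ε := self_mem_nhdsWithin
  obtain ⟨ε, ⟨h1, h2⟩, h3⟩ :=
    (((hdom.and hineq).filter_mono nhdsWithin_le_nhds).and hgt).exists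
  refine ⟨path ε, ε, h3, h1, fun i => ⟨h2 i, fun t => ?_⟩⟩
  have ha : ∀ j, P.a i j (path ε j) t = P.a i j (x j) t + ε * ∑ u, P.A i j t u * d₀ ⟨j, u⟩ := by
    intro j
    simp only [path, d, a, Pi.add_apply, Pi.smul_apply, WithLp.ofLp_add, WithLp.ofLp_smul,
      Matrix.mulVec_add, Matrix.mulVec_smul, PiLp.sub_apply, smul_eq_mul, Matrix.mulVec,
      dotProduct]
    ring
  have hd := congrFun hd₀ ⟨i, t⟩
  simp only [Matrix.mulVec, dotProduct, bigA, ite_mul, zero_mul, Fintype.sum_sigma] at hd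
  have hd' : ∑ j ∈ P.nbrs i, ∑ u, P.A i j t u * d₀ ⟨j, u⟩ = v i t := by
    rw [← hd, ← Finset.sum_filter_add_sum_filter_not Finset.univ (· ∈ P.nbrs i)]
    rw [Finset.sum_eq_zero (s := Finset.univ.filter (· ∉ P.nbrs i))]
    · rw [add_zero, Finset.filter_univ_mem]
      exact Finset.sum_congr rfl fun j hj => by simp [hj]
    · intro j hj
      simp [(Finset.mem_filter.1 hj).2]
  have hx0 := congrArg (fun w : EuclideanSpace ℝ (Fin (P.r i)) => w t) (hxc i).2
  simp only [WithLp.ofLp_sum, Finset.sum_apply, PiLp.zero_apply] at hx0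
  rw [total_inr, WithLp.ofLp_sum, Finset.sum_apply, Finset.sum_congr rfl fun j _ => ha j,
    Finset.sum_add_distrib, hx0, ← Finset.mul_sum, hd', zero_add]

lemma sum_lag_le {y : P.Dual} {x z : P.Primal} (hx : ∀ j, P.IsResponse y j (x j))
    (hz : ∀ j, z j ∈ effDom (P.f j)) : ∑ j, P.lag y j (x j) ≤ ∑ j, P.lag y j (z j) :=
  Finset.sum_le_sum fun j _ => IsArgmin.le_toReal (hP.proper j) (hx j) (hz j)

/-- The superlevel sets of the dual function are bounded. -/
lemma exists_dual_bound (c : ℝ) : ∃ B : ℝ, ∀ y : P.Dual, (∀ i, y i ∈ P.Ω i) → ∀ x : P.Primal,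
    (∀ j, P.IsResponse y j (x j)) → c ≤ ∑ j, P.lag y j (x j) → ∀ i, ‖y i‖ ≤ B := by
  classical
  have hcoord : ∀ i s, ∃ B : ℝ, ∀ y : P.Dual, (∀ i, y i ∈ P.Ω i) → ∀ x : P.Primal,
      (∀ j, P.IsResponse y j (x j)) → c ≤ ∑ j, P.lag y j (x j) → |y i s| ≤ B := by
    rintro i (s | t)
    -- At a strictly feasible `z` every term `y_s * total_s` is nonpositive; keeping only one gives
    -- `c ≤ f(z) + y_s * total_s`, which bounds `y_s`.
    · obtain ⟨z, ε, hε, hz, h⟩ := hP.exists_perturbation (fun _ _ => 0)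
      simp only [mul_zero] at h
      refine ⟨(∑ j, (P.f j (z j)).toReal - c) / (-P.total z i (Sum.inl s)), fun y hy x hx hc => ?_⟩
      have h1 := (h i).1 s
      rw [abs_of_nonneg (hy i s), le_div_iff₀ (by linarith)]
      have h2 := hP.sum_lag_le hx hz
      rw [P.sum_lag y z] at h2
      have hneg : ∀ i s, y i (Sum.inl s) * P.total z i (Sum.inl s) ≤ 0 := fun i s =>
        mul_nonpos_of_nonneg_of_nonpos (hy i s) ((h i).1 s).le
      have h3 : ∀ i, inner ℝ (P.total z i) (y i) =
          ∑ s, y i (Sum.inl s) * P.total z i (Sum.inl s) := fun i =>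
        P.inner_total_of_eq (h i).2 _
      have h4 : ∑ i, inner ℝ (P.total z i) (y i) ≤ inner ℝ (P.total z i) (y i) := by
        rw [← Finset.add_sum_erase _ _ (Finset.mem_univ i)]
        have := Finset.sum_nonpos (s := Finset.univ.erase i)
          (f := fun i => inner ℝ (P.total z i) (y i)) fun i _ => by
            simp only [h3]; exact Finset.sum_nonpos fun s _ => hneg i s
        linarith
      have h5 : ∑ s, y i (Sum.inl s) * P.total z i (Sum.inl s) ≤
          y i (Sum.inl s) * P.total z i (Sum.inl s) := by
        rw [← Finset.add_sum_erase _ _ (Finset.mem_univ s)]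
        have := Finset.sum_nonpos (s := Finset.univ.erase s)
          (f := fun s => y i (Sum.inl s) * P.total z i (Sum.inl s)) fun s _ => hneg i s
        linarith
      have := h3 i
      linarith
    -- Perturbing one equality by `ε σ` gives `c ≤ f(z) + ε σ y_t`; `σ = ±1` bounds `y_t` on both
    -- sides.
    · have hside : ∀ σ : ℝ, ∃ B : ℝ, ∀ y : P.Dual, (∀ i, y i ∈ P.Ω i) → ∀ x : P.Primal,
          (∀ j, P.IsResponse y j (x j)) → c ≤ ∑ j, P.lag y j (x j) →
          -(σ * y i (Sum.inr t)) ≤ B := by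
        intro σ
        obtain ⟨z, ε, hε, hz, h⟩ := hP.exists_perturbation
          (Pi.single i (Pi.single t σ))
        refine ⟨(∑ j, (P.f j (z j)).toReal - c) / ε, fun y hy x hx hc => ?_⟩
        rw [le_div_iff₀ hε]
        have h2 := hP.sum_lag_le hx hz
        rw [P.sum_lag y z] at h2
        have h3 : ∀ k, inner ℝ (P.total z k) (y k) ≤
            ∑ u, y k (Sum.inr u) * (ε * (Pi.single i (Pi.single t σ) :
              ∀ i, Fin (P.r i) → ℝ) k u) := fun k => by
          rw [inner_total]
          have h4 : ∑ s, y k (Sum.inl s) * P.total z k (Sum.inl s) ≤ 0 :=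
            Finset.sum_nonpos fun s _ =>
              mul_nonpos_of_nonneg_of_nonpos (hy k s) ((h k).1 s).le
          have h5 := Finset.sum_congr rfl fun u (_ : u ∈ Finset.univ) =>
            congrArg (y k (Sum.inr u) * ·) ((h k).2 u)
          simp only at h5
          linarith
        have h4 := Finset.sum_le_sum fun k (_ : k ∈ Finset.univ) => h3 k
        have h5 : ∑ k, ∑ u, y k (Sum.inr u) * (ε * (Pi.single i (Pi.single t σ) :
              ∀ i, Fin (P.r i) → ℝ) k u) = y i (Sum.inr t) * (ε * σ) := by
          rw [Finset.sum_eq_single i, Finset.sum_eq_single t]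
          · simp
          · intro u _ hu
            simp [hu]
          · simp
          · intro k _ hk
            simp [hk]
          · simp
        linarith
      obtain ⟨B₁, h₁⟩ := hside 1
      obtain ⟨B₂, h₂⟩ := hside (-1)
      refine ⟨max B₁ B₂, fun y hy x hx hc => abs_le.2 ⟨?_, ?_⟩⟩
      · have := h₁ y hy x hx hc
        have := le_max_left B₁ B₂
        linarith
      · have := h₂ y hy x hx hc
        have := le_max_right B₁ B₂
        linarith
  choose B hB using hcoord
  refine ⟨∑ i, ∑ s, |B i s|, fun y hy x hx hc i => ?_⟩
  calc ‖y i‖ ≤ ∑ s, |y i s| := EuclideanSpace.norm_le_sum_abs _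
    _ ≤ ∑ s, |B i s| := Finset.sum_le_sum fun s _ =>
        (hB i s y hy x hx hc).trans (le_abs_self _)
    _ ≤ ∑ i, ∑ s, |B i s| := Finset.single_le_sum (f := fun i => ∑ s, |B i s|)
        (fun i _ => Finset.sum_nonneg fun s _ => abs_nonneg _) (Finset.mem_univ i)

end Regular

end CoupledProblem

/-! ### Delay windows and recursion on the history. -/

lemma norm_sub_sq_le_sum_steps {E : Type*} [SeminormedAddCommGroup E] (v : ℕ → E) {k d M : ℕ}
    (h1 : d ≤ k) (h2 : k ≤ d + M) :
    ‖v k - v d‖ ^ 2 ≤ M * ∑ s ∈ Finset.Ico (k - M) k, ‖v (s + 1) - v s‖ ^ 2 := by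
  have h3 : ‖v k - v d‖ ≤ ∑ s ∈ Finset.Ico (k - M) k, ‖v (s + 1) - v s‖ := by
    have h := dist_le_Ico_sum_dist (v) h1
    rw [dist_comm, dist_eq_norm] at h
    refine h.trans ?_
    have hd : ∀ s, dist (v s) (v (s + 1)) = ‖v (s + 1) - v s‖ := fun s => by
      rw [dist_comm, dist_eq_norm]
    simp only [hd]
    exact Finset.sum_le_sum_of_subset_of_nonneg (Finset.Ico_subset_Ico (by omega) le_rfl)
      fun _ _ _ => norm_nonneg _
  calc ‖v k - v d‖ ^ 2 ≤ (∑ s ∈ Finset.Ico (k - M) k, ‖v (s + 1) - v s‖) ^ 2 := by gcongr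
    _ ≤ ((Finset.Ico (k - M) k).card : ℝ) *
        ∑ s ∈ Finset.Ico (k - M) k, ‖v (s + 1) - v s‖ ^ 2 := sq_sum_le_card_mul_sum_sq
    _ ≤ _ := by
      gcongr
      rw [Nat.card_Ico]
      omega

/-- A sequence defined by recursion on its whole history. -/
def historySeq {S : Type*} (s₀ : S) (F : ℕ → (ℕ → S) → S) : ℕ → S
  | 0 => s₀
  -- Capping at `k` makes the recursion well founded and changes nothing for times at most `k`.
  | k + 1 => F k fun m => historySeq s₀ F (min m k)
  termination_by k => k
  decreasing_by omega

/-- A step `s` lies only in the windows of `k = s + 1, …, s + M`. -/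
lemma sum_window_le {b : ℕ → ℝ} (hb : ∀ k, 0 ≤ b k) (M K : ℕ) :
    ∑ k ∈ Finset.range K, ∑ s ∈ Finset.Ico (k - M) k, b s ≤
      M * ∑ s ∈ Finset.range K, b s := by
  rw [Finset.sum_comm' (t' := Finset.range K)
    (s' := fun s => Finset.Ico (s + 1) (min K (s + M + 1)))
    (by intro k s; simp only [Finset.mem_range, Finset.mem_Ico]; omega), Finset.mul_sum]
  refine Finset.sum_le_sum fun s _ => ?_
  rw [Finset.sum_const, nsmul_eq_mul, Nat.card_Ico]
  have : ((min K (s + M + 1) - (s + 1) : ℕ) : ℝ) ≤ M := by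
    exact_mod_cast (by omega : min K (s + M + 1) - (s + 1) ≤ M)
  exact mul_le_mul_of_nonneg_right this (hb s)

lemma telescope_delayed {D a b : ℕ → ℝ} (hb : ∀ k, 0 ≤ b k) (M : ℕ)
    (h : ∀ k, D k + a k - 1 / 2 * ∑ s ∈ Finset.Ico (k - M) k, b s ≤ D (k + 1)) (K : ℕ) :
    D 0 + ∑ k ∈ Finset.range K, (a k - M / 2 * b k) ≤ D K := by
  have h1 : ∑ k ∈ Finset.range K, (a k - 1 / 2 * ∑ s ∈ Finset.Ico (k - M) k, b s) ≤
      ∑ k ∈ Finset.range K, (D (k + 1) - D k) :=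
    Finset.sum_le_sum fun k _ => by linarith [h k]
  rw [Finset.sum_range_sub, Finset.sum_sub_distrib, ← Finset.mul_sum] at h1
  rw [Finset.sum_sub_distrib, ← Finset.mul_sum]
  have := sum_window_le hb M K
  linarith

/-! ### Existence of runs and delayed dual ascent. -/

namespace CoupledProblem

variable {ι : Type*} {P : CoupledProblem ι} [Fintype ι] {ρ : ι → ℝ} {θ : ι → ι → ℝ}
  {Q : ℕ} {T : ι → Set ℕ} {τ : ι → ι → ℕ → ℕ} {γ : ι → ℝ}

lemma isResponse_zero_iff {j : ι} {z : EuclideanSpace ℝ (Fin (P.n j))} :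
    P.IsResponse 0 j z ↔ IsArgmin (P.f j) z := by
  simp [IsResponse, pen]

lemma exists_isRun (hP : P.Regular ρ θ) (hτ : ∀ k i, ∀ j ∈ P.nbrs i, τ i j k ≤ k) :
    ∃ (x : ℕ → P.Primal) (y : ℕ → P.Dual), P.IsRun γ T τ x y := by
  classical
  choose pr hpr using fun i (u : P.DualBlock i) =>
    exists_isProj ⟨0, P.zero_mem_Ω i⟩ (P.convex_Ω i) (P.isClosed_Ω i) u
  -- A total choice is needed before the multipliers are known to stay in `Ω`, where responses
  -- exist.
  let resp : P.Dual → P.Primal := fun y i => Classical.epsilon (P.IsResponse y i)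
  have hresp : ∀ y : P.Dual, (∀ i, y i ∈ P.Ω i) → ∀ i, P.IsResponse y i (resp y i) :=
    fun y hy i => Classical.epsilon_spec (hP.exists_isResponse hy i)
  let step : ℕ → (ℕ → P.Primal × P.Dual) → P.Primal × P.Dual := fun k past =>
    (fun i => if k ∈ T i then resp (fun l => (past (τ i l k)).2 l) i else (past k).1 i,
     fun i => if k ∈ T i then
        pr i ((past k).2 i + γ i • ∑ j ∈ P.nbrs i, P.g i j ((past (τ i j k)).1 j))
      else (past k).2 i)
  let S := historySeq (resp 0, (0 : P.Dual)) step
  have hS0 : S 0 = (resp 0, 0) := by simp only [S, historySeq]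
  have hS : ∀ k, S (k + 1) = step k fun m => S (min m k) := fun k => by
    simp only [S]
    rw [historySeq]
  have hmem : ∀ k i, (S k).2 i ∈ P.Ω i := by
    intro k
    induction k with
    | zero => intro i; rw [hS0]; exact P.zero_mem_Ω i
    | succ k ih =>
      intro i
      rw [hS]
      simp only [step]
      split_ifs
      · exact (hpr i _).1
      · simpa using ih i
  refine ⟨fun k => (S k).1, fun k => (S k).2, ⟨fun i => by simp [hS0], fun i => ?_, ?_, ?_, ?_, ?_⟩⟩
  · simp only [hS0]
    exact isResponse_zero_iff.1 (hresp 0 (fun i => P.zero_mem_Ω i) i)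
  · intro k i hk
    have h1 : (S (k + 1)).1 i = resp (fun l => (S (min (τ i l k) k)).2 l) i := by
      rw [hS]
      simp [step, hk]
    have h2 := hresp (fun l => (S (min (τ i l k) k)).2 l) (fun l => hmem _ l) i
    rw [← h1] at h2
    have h3 : ∀ z, P.pen (fun l => (S (min (τ i l k) k)).2 l) i z =
        ∑ j ∈ P.nbrs i, inner ℝ (P.g j i z) ((S (τ i j k)).2 j) := fun z =>
      Finset.sum_congr rfl fun j hj => by simp only [min_eq_left (hτ k i j hj)]
    simpa only [IsResponse, h3] using h2
  · intro k i hk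
    have h1 : (S (k + 1)).2 i = pr i ((S k).2 i +
        γ i • ∑ j ∈ P.nbrs i, P.g i j ((S (τ i j k)).1 j)) := by
      rw [hS]
      simp only [step, hk, if_true, min_self]
      rw [Finset.sum_congr rfl fun j hj => by rw [min_eq_left (hτ k i j hj)]]
    simp only [h1]
    exact hpr i _
  · intro k i hk
    simp only [hS]
    simp [step, hk]
  · intro k i hk
    simp only [hS]
    simp [step, hk]

namespace IsRun

variable {x : ℕ → P.Primal} {y : ℕ → P.Dual} (hr : P.IsRun γ T τ x y)
include hr

lemma dual_mem (k : ℕ) (i : ι) : y k i ∈ P.Ω i := by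
  induction k with
  | zero => rw [hr.y_init]; exact P.zero_mem_Ω i
  | succ k ih =>
    by_cases hk : k ∈ T i
    · exact (hr.y_update k i hk).1
    · rwa [hr.y_idle k i hk]

lemma last_update (t : ℕ) (j : ι) : ((∀ s < t, s ∉ T j) ∧ x t j = x 0 j) ∨
    ∃ s < t, s ∈ T j ∧ (∀ s', s < s' → s' < t → s' ∉ T j) ∧ x t j = x (s + 1) j := by
  induction t with
  | zero => left; exact ⟨fun s hs => absurd hs (Nat.not_lt_zero s), rfl⟩
  | succ t ih =>
    by_cases ht : t ∈ T j
    · exact Or.inr ⟨t, Nat.lt_succ_self t, ht, fun s' h1 h2 => by omega, rfl⟩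
    · rw [hr.x_idle t j ht]
      rcases ih with ⟨h1, h2⟩ | ⟨s, hst, hs, h1, h2⟩
      · refine Or.inl ⟨fun s hs => ?_, h2⟩
        rcases Nat.lt_succ_iff_lt_or_eq.1 hs with h | rfl
        · exact h1 s h
        · exact ht
      · refine Or.inr ⟨s, by omega, hs, fun s' h3 h4 => ?_, h2⟩
        rcases Nat.lt_succ_iff_lt_or_eq.1 h4 with h | rfl
        · exact h1 s' h3 h
        · exact ht

/-- Every primal iterate is a response to multipliers that are not too old. -/
lemma exists_delay (hA : P.PartiallyAsync Q T τ) (t : ℕ) (j : ι) :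
    ∃ d : ι → ℕ, (∀ l ∈ P.nbrs j, d l ≤ t ∧ t ≤ d l + 2 * Q) ∧
      P.IsResponse (fun l => y (d l) l) j (x t j) := by
  rcases hr.last_update t j with ⟨h1, h2⟩ | ⟨s, hst, hs, h1, h2⟩
  -- No update before `t` forces `t ≤ Q - 1`, and the initial point is the response to zero
  -- multipliers.
  · obtain ⟨u, hu, -, hu2⟩ := hA.update 0 j
    have hut : t ≤ u := not_lt.1 fun h => h1 u h hu
    refine ⟨fun _ => 0, fun l _ => ⟨Nat.zero_le t, by omega⟩, ?_⟩
    rw [h2]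
    have : (fun l => y 0 l) = (0 : P.Dual) := funext hr.y_init
    rw [this, isResponse_zero_iff]
    exact hr.x_init j
  -- The next update comes by time `s + Q`, so `t ≤ s + Q`; the data used at `s` are at most `Q`
  -- older.
  · obtain ⟨u, hu, hu1, hu2⟩ := hA.update (s + 1) j
    have hut : t ≤ u := not_lt.1 fun h => h1 u (by omega) h hu
    refine ⟨fun l => τ j l s, fun l hl => ?_, ?_⟩
    · have := hA.not_future s j l hl
      have := hA.delay s j l hl
      have := hA.Q_pos
      change τ j l s ≤ t ∧ t ≤ τ j l s + 2 * Q
      omega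
    · rw [h2]
      exact hr.x_update s j hs

/-- The delayed primal information is close to the response to the current multipliers. -/
lemma response_error (hP : P.Regular ρ θ) (hA : P.PartiallyAsync Q T τ) {k : ℕ} {X : P.Primal}
    (hX : ∀ j, P.IsResponse (y k) j (X j)) {i j : ι} (hj : j ∈ P.nbrs i) :
    ‖X j - x (τ i j k) j‖ ^ 2 ≤ (P.thetaBar θ j / ρ j) ^ 2 * (((3 * Q : ℕ) : ℝ) *
      ∑ s ∈ Finset.Ico (k - 3 * Q) k, ∑ l ∈ P.nbrs j, ‖y (s + 1) l - y s l‖ ^ 2) := by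
  obtain ⟨d, hd, hresp⟩ := hr.exists_delay hA (τ i j k) j
  have h1 := hP.response_lipschitz (fun l => hr.dual_mem (d l) l) (hr.dual_mem k) hresp (hX j)
  have hρ := hP.rho_pos j
  have h2 : (ρ j * ‖X j - x (τ i j k) j‖) ^ 2 ≤
      (∑ l ∈ P.nbrs j, θ l j * ‖y k l - y (d l) l‖) ^ 2 := by gcongr
  have h3 := P.sum_theta_mul_le θ j fun l => ‖y k l - y (d l) l‖
  have h4 : ∑ l ∈ P.nbrs j, ‖y k l - y (d l) l‖ ^ 2 ≤ ((3 * Q : ℕ) : ℝ) *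
      ∑ s ∈ Finset.Ico (k - 3 * Q) k, ∑ l ∈ P.nbrs j, ‖y (s + 1) l - y s l‖ ^ 2 := by
    rw [Finset.sum_comm, Finset.mul_sum]
    refine Finset.sum_le_sum fun l hl => norm_sub_sq_le_sum_steps (fun s => y s l) ?_ ?_
    · exact (hd l hl).1.trans (hA.not_future k i j hj)
    · have := (hd l hl).2
      have := hA.delay k i j hj
      omega
  have h5 := mul_le_mul_of_nonneg_left h4 (sq_nonneg (P.thetaBar θ j))
  rw [div_pow, div_mul_eq_mul_div, le_div_iff₀ (by positivity)]
  rw [mul_pow] at h2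
  linarith

/-- Ascent of one dual block up to delay errors. -/
lemma inner_total_ge (hP : P.Regular ρ θ) (hA : P.PartiallyAsync Q T τ) (hγ : ∀ i, 0 < γ i)
    {k : ℕ} {X : P.Primal} (hX : ∀ j, P.IsResponse (y k) j (X j)) (i : ι) :
    (γ i)⁻¹ * ‖y (k + 1) i - y k i‖ ^ 2 -
      ∑ j ∈ P.nbrs i, θ i j * (P.thetaBar θ j / ρ j) *
        (1 / 2 * (((3 * Q : ℕ) : ℝ) * ‖y (k + 1) i - y k i‖ ^ 2 +
          ∑ s ∈ Finset.Ico (k - 3 * Q) k, ∑ l ∈ P.nbrs j, ‖y (s + 1) l - y s l‖ ^ 2)) ≤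
      inner ℝ (P.total X i) (y (k + 1) i - y k i) := by
  have hκ : ∀ j, 0 ≤ P.thetaBar θ j / ρ j := fun j =>
    div_nonneg (Real.sqrt_nonneg _) (hP.rho_pos j).le
  have hw : ∀ j ∈ P.nbrs i, 0 ≤ θ i j * (P.thetaBar θ j / ρ j) := fun j hj =>
    mul_nonneg (hP.theta_pos i j hj).le (hκ j)
  have hSnn : ∀ j, 0 ≤ ∑ s ∈ Finset.Ico (k - 3 * Q) k,
      ∑ l ∈ P.nbrs j, ‖y (s + 1) l - y s l‖ ^ 2 := fun j =>
    Finset.sum_nonneg fun _ _ => Finset.sum_nonneg fun _ _ => sq_nonneg _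
  by_cases hk : k ∈ T i
  swap
  · rw [hr.y_idle k i hk]
    simp only [sub_self, norm_zero, inner_zero_right, ne_eq, OfNat.ofNat_ne_zero,
      not_false_eq_true, zero_pow, mul_zero, zero_add, zero_sub, Left.neg_nonpos_iff]
    exact Finset.sum_nonneg fun j hj => mul_nonneg (hw j hj) (by have := hSnn j; positivity)
  set Δ := y (k + 1) i - y k i with hΔ
  set u := ∑ j ∈ P.nbrs i, P.g i j (x (τ i j k) j) with hu
  -- Projection inequality tested at the previous multiplier `y k i`.
  have h1 : (γ i)⁻¹ * ‖Δ‖ ^ 2 ≤ inner ℝ u Δ := by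
    have h := (hr.y_update k i hk).inner_le_zero (P.convex_Ω i) (y k i) (hr.dual_mem k i)
    have e1 : y k i + γ i • u - y (k + 1) i = γ i • u - Δ := by rw [hΔ]; abel
    have e2 : y k i - y (k + 1) i = -Δ := by rw [hΔ]; abel
    rw [← hu, e1, e2, inner_neg_right, inner_sub_left, real_inner_smul_left,
      real_inner_self_eq_norm_sq] at h
    rw [inv_mul_le_iff₀ (hγ i)]
    linarith
  have h2 : inner ℝ (P.total X i) Δ = inner ℝ u Δ +
      ∑ j ∈ P.nbrs i, inner ℝ (P.g i j (X j) - P.g i j (x (τ i j k) j)) Δ := by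
    rw [← sum_inner, Finset.sum_sub_distrib, ← inner_add_left, hu, total]
    congr 1
    abel
  have h3 : ∀ j ∈ P.nbrs i, -(θ i j * (P.thetaBar θ j / ρ j) *
      (1 / 2 * (((3 * Q : ℕ) : ℝ) * ‖Δ‖ ^ 2 +
        ∑ s ∈ Finset.Ico (k - 3 * Q) k, ∑ l ∈ P.nbrs j, ‖y (s + 1) l - y s l‖ ^ 2))) ≤
      inner ℝ (P.g i j (X j) - P.g i j (x (τ i j k) j)) Δ := by
    intro j hj
    set S := ∑ s ∈ Finset.Ico (k - 3 * Q) k, ∑ l ∈ P.nbrs j, ‖y (s + 1) l - y s l‖ ^ 2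
    have hS := hSnn j
    have he := hr.response_error hP hA hX hj
    obtain ⟨d, -, hresp⟩ := hr.exists_delay hA (τ i j k) j
    have hlip := hP.lipschitz i j hj _ (hP.mem_effDom (hX j)) _ (hP.mem_effDom hresp)
    have hin := neg_le_of_abs_le
      (abs_real_inner_le_norm (P.g i j (X j) - P.g i j (x (τ i j k) j)) Δ)
    have he' : ‖X j - x (τ i j k) j‖ ≤
        P.thetaBar θ j / ρ j * (√((3 * Q : ℕ) : ℝ) * √S) := by
      refine abs_le_of_sq_le_sq' ?_ (mul_nonneg (hκ j) (by positivity)) |>.2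
      rw [mul_pow, mul_pow, Real.sq_sqrt (Nat.cast_nonneg _), Real.sq_sqrt hS]
      exact he
    have ham : √((3 * Q : ℕ) : ℝ) * √S * ‖Δ‖ ≤ 1 / 2 * (((3 * Q : ℕ) : ℝ) * ‖Δ‖ ^ 2 + S) := by
      have h := two_mul_le_add_sq (√((3 * Q : ℕ) : ℝ) * ‖Δ‖) (√S)
      rw [mul_pow, Real.sq_sqrt (Nat.cast_nonneg _), Real.sq_sqrt hS] at h
      linarith
    have hfin : ‖P.g i j (X j) - P.g i j (x (τ i j k) j)‖ * ‖Δ‖ ≤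
        θ i j * (P.thetaBar θ j / ρ j) * (1 / 2 * (((3 * Q : ℕ) : ℝ) * ‖Δ‖ ^ 2 + S)) := by
      have hθ := (hP.theta_pos i j hj).le
      calc _ ≤ θ i j * (P.thetaBar θ j / ρ j * (√((3 * Q : ℕ) : ℝ) * √S)) * ‖Δ‖ := by
            gcongr
            exact hlip.trans (by gcongr)
        _ = θ i j * (P.thetaBar θ j / ρ j) * (√((3 * Q : ℕ) : ℝ) * √S * ‖Δ‖) := by ring
        _ ≤ _ := mul_le_mul_of_nonneg_left ham (hw j hj)
    linarith
  have h4 := Finset.sum_le_sum h3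
  rw [Finset.sum_neg_distrib] at h4
  linarith

/-- Increase of the dual function in one step. -/
lemma dual_ascent (hP : P.Regular ρ θ) (hA : P.PartiallyAsync Q T τ) (hγ : ∀ i, 0 < γ i)
    {k : ℕ} {X X' : P.Primal} (hX : ∀ j, P.IsResponse (y k) j (X j))
    (hX' : ∀ j, P.IsResponse (y (k + 1)) j (X' j)) :
    ∑ j, P.lag (y k) j (X j) +
      ∑ i, ((γ i)⁻¹ - 1 / 2 * P.phi ρ θ i - ((3 * Q : ℕ) : ℝ) / 2 * P.ell ρ θ i) *
        ‖y (k + 1) i - y k i‖ ^ 2 -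
      1 / 2 * ∑ s ∈ Finset.Ico (k - 3 * Q) k, ∑ i, P.xi ρ θ i * ‖y (s + 1) i - y s i‖ ^ 2 ≤
      ∑ j, P.lag (y (k + 1)) j (X' j) := by
  have h1 := Finset.sum_le_sum fun j (_ : j ∈ Finset.univ) =>
    hP.lag_ge (hr.dual_mem k) (hX j) (hX' j)
  rw [Finset.sum_sub_distrib, Finset.sum_add_distrib,
    P.sum_nbrs_comm fun j i => inner ℝ (P.g i j (X j)) (y (k + 1) i - y k i)] at h1
  have e1 : ∑ j, P.thetaBar θ j ^ 2 / ρ j / 2 *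
      ∑ i ∈ P.nbrs j, ‖y (k + 1) i - y k i‖ ^ 2 =
      ∑ i, 1 / 2 * P.phi ρ θ i * ‖y (k + 1) i - y k i‖ ^ 2 := by
    simp only [Finset.mul_sum]
    rw [P.sum_nbrs_comm]
    refine Finset.sum_congr rfl fun i _ => ?_
    rw [phi, Finset.mul_sum, Finset.sum_mul]
    exact Finset.sum_congr rfl fun j _ => by ring
  rw [e1] at h1
  have h2 := Finset.sum_le_sum fun i (_ : i ∈ Finset.univ) =>
    hr.inner_total_ge hP hA hγ hX i
  simp only [total, sum_inner] at h2
  -- The current half of the Young bound collects into `ell`; the past half, regrouped by the agent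
  -- that made the step, collects into `xi`.
  have e2 : ∑ i, ∑ j ∈ P.nbrs i, θ i j * (P.thetaBar θ j / ρ j) *
        (1 / 2 * (((3 * Q : ℕ) : ℝ) * ‖y (k + 1) i - y k i‖ ^ 2 +
          ∑ s ∈ Finset.Ico (k - 3 * Q) k, ∑ l ∈ P.nbrs j, ‖y (s + 1) l - y s l‖ ^ 2)) =
      ∑ i, ((3 * Q : ℕ) : ℝ) / 2 * P.ell ρ θ i * ‖y (k + 1) i - y k i‖ ^ 2 +
      1 / 2 * ∑ s ∈ Finset.Ico (k - 3 * Q) k, ∑ i, P.xi ρ θ i * ‖y (s + 1) i - y s i‖ ^ 2 := by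
    simp only [mul_add, Finset.sum_add_distrib]
    congr 1
    · refine Finset.sum_congr rfl fun i _ => ?_
      rw [ell, Finset.mul_sum, Finset.sum_mul]
      exact Finset.sum_congr rfl fun j _ => by ring
    · rw [P.sum_nbrs_comm]
      have e3 : ∀ s, ∑ i, P.xi ρ θ i * ‖y (s + 1) i - y s i‖ ^ 2 =
          ∑ j, ∑ i ∈ P.nbrs j, θ i j * (P.thetaBar θ j / ρ j) *
            ∑ l ∈ P.nbrs j, ‖y (s + 1) l - y s l‖ ^ 2 := fun s => by
        simp only [xi, Finset.sum_mul]
        rw [P.sum_nbrs_comm fun l j => ∑ i ∈ P.nbrs j,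
          θ i j * (P.thetaBar θ j / ρ j) * ‖y (s + 1) l - y s l‖ ^ 2]
        refine Finset.sum_congr rfl fun j _ => ?_
        rw [Finset.sum_comm]
        simp only [Finset.mul_sum]
      simp only [e3]
      rw [Finset.sum_comm, Finset.mul_sum]
      refine Finset.sum_congr rfl fun j _ => ?_
      simp only [← Finset.mul_sum, ← Finset.sum_mul]
      ring
  rw [Finset.sum_sub_distrib, e2] at h2
  simp only [sub_mul, Finset.sum_sub_distrib]
  linarith

end IsRun

end CoupledProblem

/-! ### Boundedness, cluster points and convergence. -/

namespace CoupledProblem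

variable {ι : Type*} {P : CoupledProblem ι} [Fintype ι] {ρ : ι → ℝ} {θ : ι → ι → ℝ}
  {Q : ℕ} {T : ι → Set ℕ} {τ : ι → ι → ℕ → ℕ} {γ : ι → ℝ}

/-- Weak duality: the dual function is bounded above. -/
lemma Regular.exists_dual_le (hP : P.Regular ρ θ) : ∃ U : ℝ, ∀ y : P.Dual,
    (∀ i, y i ∈ P.Ω i) → ∀ x : P.Primal, (∀ j, P.IsResponse y j (x j)) →
      ∑ j, P.lag y j (x j) ≤ U := by
  obtain ⟨z, ε, hε, hz, h⟩ := hP.exists_perturbation (fun _ _ => 0)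
  simp only [mul_zero] at h
  refine ⟨∑ j, (P.f j (z j)).toReal, fun y hy x hx => ?_⟩
  have h1 := hP.sum_lag_le hx hz
  rw [P.sum_lag y z] at h1
  have h2 : ∑ i, inner ℝ (P.total z i) (y i) ≤ 0 := Finset.sum_nonpos fun i _ => by
    rw [P.inner_total_of_eq (h i).2]
    exact Finset.sum_nonpos fun s _ => mul_nonpos_of_nonneg_of_nonpos (hy i s) ((h i).1 s).le
  linarith

lemma Regular.xi_nonneg (hP : P.Regular ρ θ) (i : ι) : 0 ≤ P.xi ρ θ i :=
  Finset.sum_nonneg fun j _ => Finset.sum_nonneg fun l hl =>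
    mul_nonneg (hP.theta_pos l j (P.mem_nbrs_comm.1 hl)).le
      (div_nonneg (Real.sqrt_nonneg _) (hP.rho_pos j).le)

namespace IsRun

variable {x : ℕ → P.Primal} {y : ℕ → P.Dual}

/-- The dual iterates are bounded and their steps vanish. -/
lemma dual_bounded_and_steps_tendsto (hr : P.IsRun γ T τ x y) (hP : P.Regular ρ θ)
    (hA : P.PartiallyAsync Q T τ) (hγ_pos : ∀ i, 0 < γ i)
    (hγ : ∀ i, (γ i)⁻¹ > 1 / 2 * P.phi ρ θ i +
      3 / 2 * (Q : ℝ) * (P.ell ρ θ i + P.xi ρ θ i)) :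
    (∃ B : ℝ, ∀ k i, ‖y k i‖ ≤ B) ∧
      ∀ i, Filter.Tendsto (fun k => dist (y k i) (y (k + 1) i)) Filter.atTop (𝓝 0) := by
  choose X hX using fun k j => hP.exists_isResponse (hr.dual_mem k) j
  set D : ℕ → ℝ := fun k => ∑ j, P.lag (y k) j (X k j) with hD
  set σ : ι → ℝ := fun i => (γ i)⁻¹ - 1 / 2 * P.phi ρ θ i -
    3 / 2 * (Q : ℝ) * (P.ell ρ θ i + P.xi ρ θ i) with hσ
  have hσ_pos : ∀ i, 0 < σ i := fun i => by have := hγ i; simp only [hσ]; linarith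
  have htel := telescope_delayed (D := D)
    (a := fun k => ∑ i, ((γ i)⁻¹ - 1 / 2 * P.phi ρ θ i - ((3 * Q : ℕ) : ℝ) / 2 * P.ell ρ θ i) *
        ‖y (k + 1) i - y k i‖ ^ 2)
    (b := fun s => ∑ i, P.xi ρ θ i * ‖y (s + 1) i - y s i‖ ^ 2)
    (fun s => Finset.sum_nonneg fun i _ => mul_nonneg (hP.xi_nonneg i) (sq_nonneg _)) (3 * Q)
    (fun k => hr.dual_ascent hP hA hγ_pos (hX k) (hX (k + 1)))
  have hdesc : ∀ K, D 0 + ∑ k ∈ Finset.range K, ∑ i, σ i * ‖y (k + 1) i - y k i‖ ^ 2 ≤ D K := by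
    intro K
    refine le_of_eq_of_le ?_ (htel K)
    congr 1
    refine Finset.sum_congr rfl fun k _ => ?_
    rw [Finset.mul_sum, ← Finset.sum_sub_distrib]
    refine Finset.sum_congr rfl fun i _ => ?_
    simp only [hσ]
    push_cast
    ring
  have hnn : ∀ k, 0 ≤ ∑ i, σ i * ‖y (k + 1) i - y k i‖ ^ 2 := fun k =>
    Finset.sum_nonneg fun i _ => mul_nonneg (hσ_pos i).le (sq_nonneg _)
  constructor
  · obtain ⟨B, hB⟩ := hP.exists_dual_bound (D 0)
    refine ⟨B, fun k => hB (y k) (hr.dual_mem k) (X k) (hX k) ?_⟩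
    have h1 := hdesc k
    have h2 := Finset.sum_nonneg fun j (_ : j ∈ Finset.range k) => hnn j
    simp only [hD] at h1 ⊢
    linarith
  · obtain ⟨U, hU⟩ := hP.exists_dual_le
    have hsum := summable_of_sum_range_le hnn (c := U - D 0) fun K => by
      have h1 := hdesc K
      have h2 := hU (y K) (hr.dual_mem K) (X K) (hX K)
      simp only [hD] at h1 ⊢
      linarith
    intro i
    have h0 := hsum.tendsto_atTop_zero.const_mul (σ i)⁻¹
    rw [mul_zero] at h0
    have hsq : Filter.Tendsto (fun k => ‖y (k + 1) i - y k i‖ ^ 2) Filter.atTop (𝓝 0) := by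
      refine squeeze_zero (fun _ => sq_nonneg _) (fun k => ?_) h0
      have h1 := Finset.single_le_sum (f := fun i => σ i * ‖y (k + 1) i - y k i‖ ^ 2)
        (fun i _ => mul_nonneg (hσ_pos i).le (sq_nonneg _)) (Finset.mem_univ i)
      rw [inv_mul_eq_div, le_div_iff₀ (hσ_pos i)]
      linarith
    have h := hsq.sqrt
    rw [Real.sqrt_zero] at h
    refine h.congr fun k => ?_
    rw [Real.sqrt_sq (norm_nonneg _), dist_comm, dist_eq_norm]

/-- Every subsequence of the primal iterates has a further subsequence that converges to
the unique solution. -/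
lemma exists_subseq_tendsto_solution (hr : P.IsRun γ T τ x y) (hP : P.Regular ρ θ)
    (hA : P.PartiallyAsync Q T τ) (hγ_pos : ∀ i, 0 < γ i)
    (hγ : ∀ i, (γ i)⁻¹ > 1 / 2 * P.phi ρ θ i +
      3 / 2 * (Q : ℝ) * (P.ell ρ θ i + P.xi ρ θ i))
    {ns : ℕ → ℕ} (hns : Filter.Tendsto ns Filter.atTop Filter.atTop) :
    ∃ (ms : ℕ → ℕ) (z : P.Primal), P.IsSolution z ∧ (∀ w, P.IsSolution w → w = z) ∧
      Filter.Tendsto (fun k => x (ns (ms k))) Filter.atTop (𝓝 z) := by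
  obtain ⟨⟨B, hB⟩, hstep⟩ := hr.dual_bounded_and_steps_tendsto hP hA hγ_pos hγ
  obtain ⟨ybar, -, φ, hφ, hlim⟩ := tendsto_subseq_of_bounded
    -- `max B 0`, because `B` may be negative when there are no agents.
    (Metric.isBounded_closedBall (x := (0 : P.Dual)) (r := max B 0))
    (x := fun k => y (ns k)) fun k => by
      rw [mem_closedBall_zero_iff, pi_norm_le_iff_of_nonneg (le_max_right _ _)]
      exact fun i => (hB _ i).trans (le_max_left _ _)
  set n : ℕ → ℕ := fun k => ns (φ k) with hn
  have hn_top : Filter.Tendsto n Filter.atTop Filter.atTop := hns.comp hφ.tendsto_atTop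
  have hlim' : ∀ i, Filter.Tendsto (fun k => y (n k) i) Filter.atTop (𝓝 (ybar i)) := fun i =>
    (tendsto_pi_nhds.1 hlim) i
  have hmem : ∀ i, ybar i ∈ P.Ω i := fun i =>
    (P.isClosed_Ω i).mem_of_tendsto (hlim' i) (Filter.Eventually.of_forall fun k =>
      hr.dual_mem (n k) i)
  choose X hX using fun j => hP.exists_isResponse hmem j
  have hy_shift : ∀ i M, ∀ m : ℕ → ℕ, (∀ k, m k ≤ n k + M) → (∀ k, n k ≤ m k + M) →
      Filter.Tendsto (fun k => y (m k) i) Filter.atTop (𝓝 (ybar i)) := by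
    intro i M m h1 h2
    have h3 := tendsto_dist_of_bounded_shift (hstep i) M hn_top h1 h2
    have h4 : Filter.Tendsto (fun k => dist (y (n k) i) (y (m k) i)) Filter.atTop (𝓝 0) := by
      simpa only [dist_comm] using h3
    exact (hlim' i).congr_dist h4
  have hx_shift : ∀ j M, ∀ m : ℕ → ℕ, (∀ k, m k ≤ n k + M) → (∀ k, n k ≤ m k + M) →
      Filter.Tendsto (fun k => x (m k) j) Filter.atTop (𝓝 (X j)) := by
    intro j M m h1 h2
    choose d hd hresp using fun k => hr.exists_delay hA (m k) j
    have h3 : Filter.Tendsto (fun k => (ρ j)⁻¹ * ∑ l ∈ P.nbrs j,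
        θ l j * ‖y (d k l) l - ybar l‖) Filter.atTop (𝓝 0) := by
      have h4 : ∀ l ∈ P.nbrs j, Filter.Tendsto (fun k => θ l j * ‖y (d k l) l - ybar l‖)
          Filter.atTop (𝓝 0) := fun l hl => by
        have h5 := hy_shift l (M + 2 * Q) (fun k => d k l)
          (fun k => by have := (hd k l hl).1; have := h1 k; omega)
          (fun k => by have := (hd k l hl).2; have := h2 k; omega)
        simpa using (tendsto_iff_norm_sub_tendsto_zero.1 h5).const_mul (θ l j)
      simpa using (tendsto_finsetSum _ h4).const_mul (ρ j)⁻¹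
    rw [tendsto_iff_norm_sub_tendsto_zero]
    refine squeeze_zero (fun _ => norm_nonneg _) (fun k => ?_) h3
    have h4 := hP.response_lipschitz hmem (fun l => hr.dual_mem (d k l) l) (hX j) (hresp k)
    rwa [inv_mul_eq_div, le_div_iff₀ (hP.rho_pos j), mul_comm]
  have hkkt := hP.isSolution_of_kkt hmem hX fun i w hw => by
    -- At an update time within `Q` of `n k`, old and new multipliers share the limit `ybar i`, so
    -- the limiting projection inequality reads `γ_i ⟨total X i, w - ybar i⟩ ≤ 0`.
    choose t htT ht1 ht2 using fun k => hA.update (n k) i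
    have hQ := hA.Q_pos
    have hy0 := hy_shift i Q t (fun k => by have := ht2 k; omega)
      (fun k => by have := ht1 k; omega)
    have hy1 := hy_shift i Q (fun k => t k + 1) (fun k => by have := ht2 k; omega)
      (fun k => by have := ht1 k; omega)
    have hu : Filter.Tendsto (fun k => ∑ j ∈ P.nbrs i, P.g i j (x (τ i j (t k)) j)) Filter.atTop
        (𝓝 (P.total X i)) := by
      refine tendsto_finsetSum _ fun j hj => ?_
      have h1 := hx_shift j (2 * Q) (fun k => τ i j (t k))
        (fun k => by have := ht2 k; have := hA.not_future (t k) i j hj; omega)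
        (fun k => by have := ht1 k; have := hA.delay (t k) i j hj; omega)
      refine (hP.continuousOn_g hj (X j) (hP.mem_effDom (hX j))).tendsto.comp
        (tendsto_nhdsWithin_iff.2 ⟨h1, Filter.Eventually.of_forall fun k => ?_⟩)
      obtain ⟨d, -, hresp⟩ := hr.exists_delay hA (τ i j (t k)) j
      exact hP.mem_effDom hresp
    have hvi : ∀ k, inner ℝ (y (t k) i + γ i • ∑ j ∈ P.nbrs i, P.g i j (x (τ i j (t k)) j) -
        y (t k + 1) i) (w - y (t k + 1) i) ≤ 0 := fun k =>
      (hr.y_update (t k) i (htT k)).inner_le_zero (P.convex_Ω i) w hw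
    have h2 := le_of_tendsto' (((hy0.add (hu.const_smul (γ i))).sub hy1).inner
      (tendsto_const_nhds.sub hy1)) hvi
    rw [add_sub_cancel_left, real_inner_smul_left] at h2
    exact nonpos_of_mul_nonpos_right h2 (hγ_pos i)
  exact ⟨φ, X, hkkt.1, hkkt.2, tendsto_pi_nhds.2 fun j =>
    hx_shift j 0 n (fun k => le_rfl) (fun k => le_rfl)⟩

end IsRun

end CoupledProblem

end

theorem theorem1 {ι : Type*} [Fintype ι] (P : CoupledProblem ι)
    (ρ : ι → ℝ) (θ : ι → ι → ℝ) (hP : P.Regular ρ θ)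
    (Q : ℕ) (T : ι → Set ℕ) (τ : ι → ι → ℕ → ℕ) (hA : P.PartiallyAsync Q T τ)
    (γ : ι → ℝ) (hγ_pos : ∀ i, 0 < γ i)
    (hγ : ∀ i, (γ i)⁻¹ > 1 / 2 * P.phi ρ θ i +
      3 / 2 * (Q : ℝ) * (P.ell ρ θ i + P.xi ρ θ i)) :
    ∃ xstar : P.Primal,
      P.IsSolution xstar ∧ (∀ z, P.IsSolution z → z = xstar) ∧
      (∃ (x : ℕ → P.Primal) (y : ℕ → P.Dual), P.IsRun γ T τ x y) ∧
      ∀ (x : ℕ → P.Primal) (y : ℕ → P.Dual), P.IsRun γ T τ x y →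
        Filter.Tendsto x Filter.atTop (𝓝 xstar) := by
  obtain ⟨x₀, y₀, h₀⟩ := CoupledProblem.exists_isRun (T := T) (γ := γ) hP hA.not_future
  -- Existence of a solution is itself read off from a run.
  obtain ⟨-, xstar, hsol, huniq, -⟩ :=
    h₀.exists_subseq_tendsto_solution hP hA hγ_pos hγ Filter.tendsto_id
  refine ⟨xstar, hsol, huniq, ⟨x₀, y₀, h₀⟩, fun x y hr => ?_⟩
  refine Filter.tendsto_of_subseq_tendsto fun ns hns => ?_
  obtain ⟨ms, z, hz, -, hlim⟩ := hr.exists_subseq_tendsto_solution hP hA hγ_pos hγ hns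
  rw [huniq z hz] at hlim
  exact ⟨ms, hlim⟩
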